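/- **Setting.** Let $m\ge 1$ be the number of servers, $c>0$ the chunk size, $\mu>0$ the service rate of each server, $\lambda>0$ the total request rate, $(\alpha_k)_{k\ge0}$ integers with $\alpha_k\ge k$, and $\pi=(\pi_k)_{k\ge 0}$ a probability mass function on $\mathbb Z_+$. Requests arrive according to a Poisson process of rate $\lambda$; let $\tau_n$ be the (i.i.d. exponential($\lambda$)) interarrival times. The $n$-th request ($n\ge0$) is for a file of $\kappa_n$ chunks, with $\kappa_n$ i.i.d. of law $\pi$. Given $\kappa_n=k$, the placement vector $a_n\in\mathbb Z_+^m$ equals $\lfloor\alpha_k/m\rfloor+1$ on $\alpha_k-m\lfloor\alpha_k/m\rfloor$ servers chosen uniformly at random and $\lfloor\alpha_k/m\rfloor$ on the others. A routing vector $s_n\le a_n$ with $|s_n|=\kappa_n$ is then chosen by one of the following policies, where $W_n$ is the workload vector seen by the request, $W_0=0$ and $W_{n+1}=(W_n+cs_n-\mu\tau_n\mathbf 1)^+$. * $\mathcal{BR}$ (balanced random): if $\kappa_n=k$, put $q=\lfloor k/m\rfloor$ and choose a subset of size $k-mq$ of $\{i:a_n^i>q\}$ uniformly at random; $s_n^i=q+1$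 on this subset and $s_n^i=q$ off it. * $\mathcal{BS}$ (batch sampling): as $\mathcal{BR}$, but the subset consists of the $k-mq$ servers of least workload $W_n^i$ in $\{i:a_n^i>q\}$, chosen successively, with ties broken uniformly at random. * $\mathcal{WF}$ (water-filling): the $k$ blocks are requested one after the other, each from a server with least updated workload ($W_n^i$ plus $c$ times the number of blocks already requested from $i$) among those for which fewer than $a_n^i$ blocks were requested so far; ties are broken uniformly at random. The sizes, placements, random choices of the policy and interarrival times are drawn independently of the past. The delay of the $n$-th request is $\max_{i:s_n^i>0}(W_n^i+cs_n^i)$ (a maximum over the empty set is $0$); for $\pi_k>0$ let $D_n^k$ be a random variable with its conditional law given $\kappa_n=k$. Let ${}^k\!s$ denote a random vector with the law of the routing vector under $\mathcal{BR}$ given $\kappa_n=k$. For nonnegative random variables, $X\le^{icx}Y$ means $E[g(X)]\le E[g(Y)]$ in $(-\infty,\infty]$ for every nondecreasing convex $g:\mathbb R\to\mathbb R$. A random vector $X$ is associated if $E[f(X)g(X)]\ge E[f(X)]E[g(X)]$ for all nondecreasing $f,g$ for which these expectations exist. Let $\Theta(m)$ be the class of those $\pi$ for which the routing vector under $\mathcal{BR}$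 is associated. The *Cavity Queue* is the M/GI/1 FCFS queue with arrival rate $\lambda$, service rate $\mu$, and service requirements with values in $\{0,c,2c,\dots\}$ and probability mass function $$\tilde\pi(0)=1-\sum_{k=1}^m\tfrac km\pi_k-\sum_{k=m+1}^\infty\pi_k,\qquad \tilde\pi(lc)=\sum_{k=(l-1)m+1}^{lm}\Big(\tfrac km-l+1\Big)\pi_k+\sum_{k=lm+1}^{(l+1)m-1}\Big(1-\tfrac km+l\Big)\pi_k\quad(l\ge1).$$ Its stationary workload law is the law $\nu$ such that if an arrival sees a workload of law $\nu$, then so does the next arrival. **Theorem.** Suppose that $\pi\in\Theta(m)$ and that $\sum_k k\pi_k<\infty$ and $\rho=c\lambda\sum_{k}k\pi_k/m<\mu$. Then the Cavity Queue has exactly one stationary workload law. Let $\tilde W^1,\dots,\tilde W^m$ be independent random variables with this law, independent of ${}^k\!s$. Then under each of the policies $\mathcal{WF}$, $\mathcal{BS}$, $\mathcal{BR}$, for all $n\ge0$ and all $k\ge0$ with $\pi_k>0$, $$D_n^k\ \le^{icx}\ \max_{i:\ {}^k\!s^i>0}\big(\tilde W^i+c\;{}^k\!s^i\big).$$ -/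

import Mathlib

open MeasureTheory ProbabilityTheory

noncomputable section

namespace MDSDelivery

/-- The uniform distribution on a finite set `S`. The value `d` only matters when `S` is empty,
which never happens for the sets occurring below when `k ≤ α k`. -/
def uniformOr {β : Type*} (S : Finset β) (d : β) : PMF β :=
  if h : S.Nonempty then PMF.uniformOfFinset S h else PMF.pure d

open Classical in
/-- The vector with entry `q + 1` on `S` and `q` elsewhere. -/
def balancedVec {m : ℕ} (q : ℕ) (S : Finset (Fin m)) : Fin m → ℕ :=
  fun i => q + if i ∈ S then 1 else 0

/-- Law of the placement vector of a file with `αk` coded blocks: `⌊αk / m⌋ + 1` blocks on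
`αk - m ⌊αk / m⌋` servers chosen uniformly at random, `⌊αk / m⌋` blocks on the others. -/
def placementLaw (m αk : ℕ) : PMF (Fin m → ℕ) :=
  (uniformOr (Finset.powersetCard (αk % m) (Finset.univ : Finset (Fin m))) ∅).map
    (balancedVec (αk / m))

open Classical in
/-- The set of minimizers of `v` over the set of servers `S`. -/
def argminServers {m : ℕ} (S : Finset (Fin m)) (v : Fin m → ℝ) : Finset (Fin m) :=
  S.filter fun i => ∀ j ∈ S, v i ≤ v j

/-- Request one more block from a server drawn uniformly from `S`, on top of the requests `s`. -/
def addBlock {m : ℕ} (S : Finset (Fin m)) (s : Fin m → ℕ) : PMF (Fin m → ℕ) :=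
  (uniformOr (S.image fun i => s + Pi.single i 1) s)

/-- Balanced random policy: `⌊k / m⌋` blocks from each server, and one more block from each server
in a uniformly random set of `k - m ⌊k / m⌋` servers among those having an additional block. -/
def balancedRandom {m : ℕ} (k : ℕ) (a : Fin m → ℕ) : PMF (Fin m → ℕ) :=
  (uniformOr (Finset.powersetCard (k % m) (Finset.univ.filter fun i => k / m < a i)) ∅).map
    (balancedVec (k / m))

/-- The first `l` choices of batch sampling: starting from `q` requests per server, successively
take the server with least workload `w i`, among the servers having an additional block and not
chosen yet (ties are broken uniformly at random). -/
def batchSamplingSteps {m : ℕ} (q : ℕ) (a : Fin m → ℕ) (w : Fin m → ℝ) : ℕ → PMF (Fin m → ℕ)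
  | 0 => PMF.pure fun _ => q
  | l + 1 => (batchSamplingSteps q a w l).bind fun s =>
      addBlock (argminServers (Finset.univ.filter fun i => q < a i ∧ s i = q) w) s

/-- Batch sampling policy. -/
def batchSampling {m : ℕ} (k : ℕ) (a : Fin m → ℕ) (w : Fin m → ℝ) : PMF (Fin m → ℕ) :=
  batchSamplingSteps (k / m) a w (k % m)

/-- Water-filling policy: the blocks are requested one after the other, each from a server with
least updated workload `w i + c * s i` among the servers with a block that is not yet requested
(ties are broken uniformly at random). -/
def waterFilling {m : ℕ} (c : ℝ) (a : Fin m → ℕ) (w : Fin m → ℝ) : ℕ → PMF (Fin m → ℕ)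
  | 0 => PMF.pure 0
  | l + 1 => (waterFilling c a w l).bind fun s =>
      addBlock (argminServers (Finset.univ.filter fun i => s i < a i)
        fun i => w i + c * (s i : ℝ)) s

/-- The three delivery policies. -/
inductive Policy
  | WF
  | BS
  | BR

/-- Law of the routing vector under a policy, for a request of `k` blocks with placement vector `a`
that sees the workload vector `w`. -/
def routingLaw {m : ℕ} (c : ℝ) : Policy → ℕ → (Fin m → ℕ) → (Fin m → ℝ) → PMF (Fin m → ℕ)
  | Policy.WF, k, a, w => waterFilling c a w k
  | Policy.BS, k, a, w => batchSampling k a w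
  | Policy.BR, k, a, _ => balancedRandom k a

/-- Law of a typical routing vector `s` under the balanced random policy subject to `|s| = k`. -/
def brLawGiven (m : ℕ) (α : ℕ → ℕ) (k : ℕ) : PMF (Fin m → ℕ) :=
  (placementLaw m (α k)).bind fun a => balancedRandom k a

/-- Law of the routing vector of an arrival under the balanced random policy. -/
def brLaw (m : ℕ) (α : ℕ → ℕ) (π : PMF ℕ) : PMF (Fin m → ℕ) :=
  π.bind fun k => brLawGiven m α k

/-- The random vector `X` is associated. -/
def IsAssociated {Ω : Type*} [MeasurableSpace Ω] {m : ℕ} (X : Ω → Fin m → ℝ)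
    (P : Measure Ω) : Prop :=
  ∀ f g : (Fin m → ℝ) → ℝ, Monotone f → Monotone g →
    Integrable (fun ω => f (X ω)) P → Integrable (fun ω => g (X ω)) P →
    Integrable (fun ω => f (X ω) * g (X ω)) P →
    (∫ ω, f (X ω) ∂P) * (∫ ω, g (X ω) ∂P) ≤ ∫ ω, f (X ω) * g (X ω) ∂P

/-- The class of size distributions for which the routing vector under the balanced random policy
is associated. -/
def Theta (m : ℕ) (α : ℕ → ℕ) : Set (PMF ℕ) :=
  {π | IsAssociated (fun (s : Fin m → ℕ) i => (s i : ℝ)) (brLaw m α π).toMeasure}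

/-- Workload vectors seen by the arrivals:
`W 0 = 0` and `W (n + 1) = (W n + c s n - μ τ n 1)⁺`. -/
def workload {Ω : Type*} {m : ℕ} (c mu : ℝ) (s : ℕ → Ω → Fin m → ℕ) (τ : ℕ → Ω → ℝ) :
    ℕ → Ω → Fin m → ℝ
  | 0, _, _ => 0
  | n + 1, ω, i => max (workload c mu s τ n ω i + c * (s n ω i : ℝ) - mu * τ n ω) 0

/-- `max_{i : s i > 0} (w i + c * s i)`, which is `0` if no block is requested. -/
def delay {m : ℕ} (c : ℝ) (w : Fin m → ℝ) (s : Fin m → ℕ) : ℝ :=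
  ⨆ i : {i : Fin m // 0 < s i}, (w i + c * (s i : ℝ))

/-- A system of `m` servers that starts empty and operates under the policy `p`: requests arrive
with independent exponential(`lam`) interarrival times `τ n`; the `n`-th request is for `κ n`
blocks with placement vector `a n` and routing vector `s n`. The σ-algebra `ℱ n` carries the past
before the `n`-th arrival. Given this past, `κ n` has law `π`, the placement vector is uniform
among the feasible ones, and the routing vector is drawn according to the policy, which sees the
current workloads. -/
structure IsSystem {Ω : Type*} [mΩ : MeasurableSpace Ω] (P : Measure Ω) (ℱ : Filtration ℕ mΩ)
    (m : ℕ) (c lam mu : ℝ) (α : ℕ → ℕ) (π : PMF ℕ) (p : Policy)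
    (κ : ℕ → Ω → ℕ) (a s : ℕ → Ω → Fin m → ℕ) (τ : ℕ → Ω → ℝ) : Prop where
  measurable_size : ∀ n, Measurable[ℱ (n + 1)] (κ n)
  measurable_placement : ∀ n, Measurable[ℱ (n + 1)] (a n)
  measurable_routing : ∀ n, Measurable[ℱ (n + 1)] (s n)
  measurable_interarrival : ∀ n, Measurable[ℱ (n + 1)] (τ n)
  condLaw : ∀ (n k : ℕ) (b r : Fin m → ℕ),
    P[Set.indicator {ω | κ n ω = k ∧ a n ω = b ∧ s n ω = r} (fun _ => (1 : ℝ)) | ℱ n]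
      =ᵐ[P] fun ω => (π k * placementLaw m (α k) b *
        routingLaw c p k b (workload c mu s τ n ω) r).toReal
  law_interarrival : ∀ n, P.map (τ n) = expMeasure lam
  indep_interarrival : ∀ n,
    Indep (MeasurableSpace.comap (τ n) inferInstance)
      (ℱ n ⊔ MeasurableSpace.comap (fun ω => (κ n ω, a n ω, s n ω)) inferInstance) P

/-- Increasing convex order for nonnegative random variables `X` (under `P`) and `Y` (under `Q`):
`E[g(X)] ≤ E[g(Y)]` for all increasing convex `g`. As `g` is bounded below on `[0, ∞)`, both
expectations exist in `(-∞, ∞]`; so there is nothing to show if `g(Y)` is not integrable, and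
otherwise `g(X)` has to be integrable, too. -/
def IcxLE {Ω Ω' : Type*} [MeasurableSpace Ω] [MeasurableSpace Ω']
    (X : Ω → ℝ) (P : Measure Ω) (Y : Ω' → ℝ) (Q : Measure Ω') : Prop :=
  ∀ g : ℝ → ℝ, Monotone g → ConvexOn ℝ Set.univ g → Integrable (fun ω => g (Y ω)) Q →
    Integrable (fun ω => g (X ω)) P ∧ ∫ ω, g (X ω) ∂P ≤ ∫ ω, g (Y ω) ∂Q

/-- Probability that the service requirement of a job in the cavity queue is `l` chunks. -/
def cavityWeight (m : ℕ) (π : PMF ℕ) : ℕ → ℝ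
  | 0 => 1 - ∑ k ∈ Finset.Icc 1 m, (k : ℝ) / m * (π k).toReal
      - ∑' k : ℕ, if m + 1 ≤ k then (π k).toReal else 0
  | l + 1 =>
      ∑ k ∈ Finset.Icc (l * m + 1) ((l + 1) * m), ((k : ℝ) / m - l) * (π k).toReal
      + ∑ k ∈ Finset.Icc ((l + 1) * m + 1) ((l + 2) * m - 1),
          (1 - (k : ℝ) / m + (l + 1)) * (π k).toReal

/-- Law of the service requirement (in bits) of a job in the cavity queue. -/
def cavityServiceLaw (m : ℕ) (c : ℝ) (π : PMF ℕ) : Measure ℝ :=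
  Measure.sum fun l : ℕ => ENNReal.ofReal (cavityWeight m π l) • Measure.dirac ((l : ℝ) * c)

/-- `ν` is a stationary law of the workload seen by the arrivals of an M/GI/1 FCFS queue with
Poisson arrivals of rate `lam`, service rate `mu` and service requirements of law `σ`: if an
arrival sees a workload of law `ν`, then so does the next one. -/
def IsStationaryWorkload (lam mu : ℝ) (σ ν : Measure ℝ) : Prop :=
  IsProbabilityMeasure ν ∧
    (ν.prod (σ.prod (expMeasure lam))).map
      (fun z : ℝ × ℝ × ℝ => max (z.1 + z.2.1 - mu * z.2.2) 0) = ν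

end MDSDelivery

end

/-!
The delay is bounded in three stages.

*From an arbitrary policy to the balanced random policy.* Call a cost of routing vectors transfer
monotone if it does not increase when one block is requested from a server with a smaller updated
workload instead. Water-filling and batch sampling are both greedy algorithms with capacities (for
batch sampling, at most one block in addition to `⌊k / m⌋` per server), and an exchange argument
shows that a greedy vector minimizes every transfer monotone cost among the feasible vectors
(`GreedyReach.cost_le`). Every increasing function of the delay is transfer monotone
(`transferMonotone_delay`), and so is every symmetric convex function of the updated workloads
(`SymmIncConvex.transferMonotone`), because the transfer replaces the vector by a convex combination
of itself and one of its transpositions. Under the balanced random policy the routing vector is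
exchangeable and does not depend on the workloads, so that the transition operator of the workload
chain preserves the class of symmetric increasing convex functions
(`SymmIncConvex.chainOp`). Induction over this operator shows that the expectations of such
functions of the workload vector are largest under the balanced random policy
(`IsSystem.lintegral_workload_le`); together with the last routing decision this bounds the expected
increasing convex costs of the delay (`IsSystem.setLIntegral_delay_le`).

*From dependent to independent servers.* Under the balanced random policy the workload vector is an
increasing function of independent associated random variables: the routing vectors, which are
associated by assumption, and the negative interarrival times, which are real random variables and
hence associated by Chebyshev's inequality. Therefore it is associated
(`associatedLaw_iterate_chainStep`), which gives positive lower orthant dependence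
(`AssociatedLaw.prod_le`): maxima of its coordinates are stochastically smaller than for independent
coordinates with the same laws.

*From transience to stationarity.* Each single server follows a Lindley recursion. A balanced
routing vector has entries `⌊k / m⌋` and `⌊k / m⌋ + 1`, and these have mean `k / m` by
exchangeability, so the increments of this recursion are those of the cavity queue
(`measurePreserving_coord`). Loynes' backward iteration and the law of large numbers show that a
Lindley recursion with negative drift has exactly one invariant law, and that this law dominates the
recursion started from an empty queue (`exists_unique_lindley_invariant`).
-/

noncomputable section

namespace MDSDelivery

open Filter Topology
open scoped ENNReal

/-! ### The Lindley recursion on the line -/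

/-- One step of the Lindley recursion: the law of `(X + ξ)⁺` for independent `X` of law `ν` and
`ξ` of law `η`. -/
def lindleyStep (η ν : Measure ℝ) : Measure ℝ :=
  (ν.prod η).map fun z => max (z.1 + z.2) 0

/-- The Lindley recursion `x ↦ (x + ξ)⁺` started from `w` and driven by the first `n` increments in
reversed order (the increment `ξ 0` is the last one to be applied), as in Loynes' construction. -/
def backward : ℕ → ℝ → (ℕ → ℝ) → ℝ
  | 0, w, _ => w
  | n + 1, w, ξ => max (backward n w (fun j => ξ (j + 1)) + ξ 0) 0

lemma measurable_backward (n : ℕ) :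
    Measurable fun z : ℝ × (ℕ → ℝ) => backward n z.1 z.2 := by
  induction n with
  | zero => exact measurable_fst
  | succ n ih =>
    have h : Measurable fun z : ℝ × (ℕ → ℝ) => (z.1, fun j => z.2 (j + 1)) := by fun_prop
    exact ((ih.comp h).add (by fun_prop)).max measurable_const

lemma measurable_backward_zero (n : ℕ) : Measurable (backward n 0) :=
  (measurable_backward n).comp measurable_prodMk_left

/-- Prepending an independent increment to an i.i.d. sequence gives an i.i.d. sequence. -/
lemma measurePreserving_cons (η : Measure ℝ) [IsProbabilityMeasure η] :
    MeasurePreserving (fun z : (ℕ → ℝ) × ℝ => (fun n => Nat.casesOn n z.2 z.1 : ℕ → ℝ))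
      ((Measure.infinitePi fun _ : ℕ => η).prod η) (Measure.infinitePi fun _ : ℕ => η) := by
  have hmeas : Measurable
      (fun z : (ℕ → ℝ) × ℝ => (fun n => Nat.casesOn n z.2 z.1 : ℕ → ℝ)) := by
    refine measurable_pi_iff.2 fun n => ?_
    cases n with
    | zero => exact measurable_snd
    | succ n => exact (measurable_pi_apply n).comp measurable_fst
  refine ⟨hmeas, Measure.eq_infinitePi _ fun s t ht => ?_⟩
  obtain ⟨N, hN⟩ : ∃ N, s ⊆ Finset.range (N + 1) :=
    ⟨s.sup id, fun i hi => Finset.mem_range.2 (Nat.lt_succ_of_le (Finset.le_sup (f := id) hi))⟩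
  classical
  let t' : ℕ → Set ℝ := fun i => if i ∈ s then t i else Set.univ
  have ht' : ∀ i, MeasurableSet (t' i) := fun i => by
    by_cases h : i ∈ s <;> simp [t', h, ht i]
  have hpre : (fun z : (ℕ → ℝ) × ℝ => (fun n => Nat.casesOn n z.2 z.1 : ℕ → ℝ)) ⁻¹' (Set.pi s t)
      = (Set.pi (Finset.range N) fun i => t' (i + 1)) ×ˢ t' 0 := by
    ext z
    simp only [Set.mem_preimage, Set.mem_pi, Set.mem_prod, Finset.coe_range, Set.mem_Iio,
      Finset.mem_coe, t']
    constructor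
    · intro h
      refine ⟨fun i _ => ?_, ?_⟩
      · by_cases hi : i + 1 ∈ s
        · simpa [hi] using h (i + 1) hi
        · simp [hi]
      · by_cases hi : 0 ∈ s
        · simpa [hi] using h 0 hi
        · simp [hi]
    · rintro ⟨h1, h2⟩ i hi
      cases i with
      | zero => simpa [hi] using h2
      | succ i =>
        have := h1 i (by have := Finset.mem_range.1 (hN hi); omega)
        simpa [hi] using this
  have hprod : ∏ i ∈ s, η (t i) = ∏ i ∈ Finset.range (N + 1), η (t' i) := by
    rw [← Finset.prod_subset hN (fun i _ hi => by simp [t', hi])]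
    exact Finset.prod_congr rfl fun i hi => by simp [t', hi]
  rw [Measure.map_apply hmeas (MeasurableSet.pi s.countable_toSet fun i _ => ht i), hpre,
    Measure.prod_prod, Measure.infinitePi_pi _ (fun i _ => ht' _), hprod, Finset.prod_range_succ']

lemma isProbabilityMeasure_lindleyStep (η ν : Measure ℝ) [IsProbabilityMeasure η]
    [IsProbabilityMeasure ν] : IsProbabilityMeasure (lindleyStep η ν) :=
  Measure.isProbabilityMeasure_map (by fun_prop)

lemma isProbabilityMeasure_iterate_lindleyStep (η ν : Measure ℝ) [IsProbabilityMeasure η]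
    [hν : IsProbabilityMeasure ν] (n : ℕ) : IsProbabilityMeasure ((lindleyStep η)^[n] ν) := by
  induction n with
  | zero => exact hν
  | succ n ih =>
    rw [Function.iterate_succ_apply']
    exact isProbabilityMeasure_lindleyStep _ _

/-- The backward iteration has the same one-dimensional laws as the forward recursion. -/
lemma measurePreserving_backward (η ν : Measure ℝ) [IsProbabilityMeasure η]
    [IsProbabilityMeasure ν] (n : ℕ) :
    MeasurePreserving (fun z : ℝ × (ℕ → ℝ) => backward n z.1 z.2)
      (ν.prod (Measure.infinitePi fun _ : ℕ => η)) ((lindleyStep η)^[n] ν) := by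
  induction n with
  | zero => exact measurePreserving_fst
  | succ n ih =>
    refine ⟨measurable_backward _, ?_⟩
    have := isProbabilityMeasure_iterate_lindleyStep η ν n
    have h1 : MeasurePreserving (fun z : ((ℝ × (ℕ → ℝ)) × ℝ) => (backward n z.1.1 z.1.2, z.2))
        ((ν.prod (Measure.infinitePi fun _ : ℕ => η)).prod η)
        (((lindleyStep η)^[n] ν).prod η) := ih.prod (MeasurePreserving.id η)
    have h2 : MeasurePreserving (fun z : ℝ × ℝ => max (z.1 + z.2) 0)
        (((lindleyStep η)^[n] ν).prod η) ((lindleyStep η)^[n + 1] ν) := by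
      rw [Function.iterate_succ_apply']
      exact ⟨by fun_prop, rfl⟩
    have h3 := ((MeasurePreserving.id ν).prod (measurePreserving_cons η)).comp
      (measurePreserving_prodAssoc ν (Measure.infinitePi fun _ : ℕ => η) η)
    rw [← h3.map_eq, ← (h2.comp h1).map_eq, Measure.map_map (measurable_backward _) h3.measurable]
    rfl

lemma backward_mono {n : ℕ} {w w' : ℝ} (h : w ≤ w') (ξ : ℕ → ℝ) :
    backward n w ξ ≤ backward n w' ξ := by
  induction n generalizing ξ with
  | zero => exact h
  | succ n ih =>
    have := ih fun j => ξ (j + 1)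
    exact max_le_max (by linarith) le_rfl

lemma backward_nonneg (n : ℕ) (ξ : ℕ → ℝ) : 0 ≤ backward n 0 ξ := by
  cases n with
  | zero => exact le_rfl
  | succ n => exact le_max_right _ _

/-- The initial workload `w` is felt after `n` steps only if the queue has not been empty in
between. -/
lemma backward_le (n : ℕ) (w : ℝ) (ξ : ℕ → ℝ) :
    backward n w ξ ≤ max (backward n 0 ξ) (w + ∑ i ∈ Finset.range n, ξ i) := by
  induction n generalizing ξ with
  | zero => simp [backward]
  | succ n ih =>
    have := ih fun j => ξ (j + 1)
    rw [Finset.sum_range_succ']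
    simp only [backward]
    rcases le_max_iff.1 this with h | h
    · exact le_max_of_le_left (max_le_max (by linarith) le_rfl)
    · exact max_le (le_max_of_le_right (by linarith)) (le_max_of_le_left (le_max_right _ _))

lemma backward_le_succ (n : ℕ) (ξ : ℕ → ℝ) : backward n 0 ξ ≤ backward (n + 1) 0 ξ := by
  induction n generalizing ξ with
  | zero => exact le_max_right _ _
  | succ n ih =>
    have := ih fun j => ξ (j + 1)
    exact max_le_max (by linarith) le_rfl

lemma backward_succ_le (n : ℕ) (ξ : ℕ → ℝ) :
    backward (n + 1) 0 ξ ≤ max (backward n 0 ξ) (∑ i ∈ Finset.range (n + 1), ξ i) := by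
  induction n generalizing ξ with
  | zero => simp [backward, max_comm]
  | succ n ih =>
    have := ih fun j => ξ (j + 1)
    rw [Finset.sum_range_succ']
    rw [backward]
    rcases le_max_iff.1 this with h | h
    · exact le_max_of_le_left (max_le_max (by linarith) le_rfl)
    · exact max_le (le_max_of_le_right (by linarith)) (le_max_of_le_left (le_max_right _ _))

/-- Limit of the backward iteration started from an empty queue. It has the junk value `0` where the
iteration is unbounded, which has probability zero if the increments have negative mean. -/
def loynes (ξ : ℕ → ℝ) : ℝ := ⨆ n, backward n 0 ξ

lemma measurable_loynes : Measurable loynes := Measurable.iSup measurable_backward_zero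

/-- If the random walk drifts to `-∞`, the backward iteration is eventually constant, whatever its
starting point. -/
lemma eventually_backward_eq {ξ : ℕ → ℝ}
    (h : Tendsto (fun n => ∑ i ∈ Finset.range n, ξ i) atTop atBot) {w : ℝ} (hw : 0 ≤ w) :
    ∀ᶠ n in atTop, backward n w ξ = loynes ξ := by
  have hmono : Monotone fun n => backward n 0 ξ := monotone_nat_of_le_succ (backward_le_succ · ξ)
  -- from `N` on, the walk stays so low that neither `w` nor the later increments are felt
  obtain ⟨N, hN⟩ := eventually_atTop.1 (h.eventually_le_atBot (-w))
  have hconst : ∀ n ≥ N, backward n 0 ξ = backward N 0 ξ := by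
    intro n hn
    induction n, hn using Nat.le_induction with
    | base => rfl
    | succ n hn ih =>
      refine le_antisymm ?_ (hmono (by omega))
      refine (backward_succ_le n ξ).trans (max_le ih.le ?_)
      exact (hN (n + 1) (by omega)).trans ((neg_nonpos.2 hw).trans (backward_nonneg _ _))
  have hle : ∀ n, backward n 0 ξ ≤ backward N 0 ξ := fun n =>
    (hmono (le_max_left n N)).trans (hconst _ (le_max_right n N)).le
  have hloynes : loynes ξ = backward N 0 ξ :=
    le_antisymm (ciSup_le hle)
    (le_ciSup (f := fun n => backward n 0 ξ) ⟨_, by rintro _ ⟨n, rfl⟩; exact hle n⟩ N)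
  filter_upwards [eventually_ge_atTop N] with n hn
  rw [hloynes, ← hconst n hn]
  refine le_antisymm ((backward_le n w ξ).trans (max_le le_rfl ?_)) (backward_mono hw ξ)
  linarith [hN n hn, backward_nonneg n ξ]

lemma backward_le_loynes {ξ : ℕ → ℝ}
    (h : Tendsto (fun n => ∑ i ∈ Finset.range n, ξ i) atTop atBot) (n : ℕ) :
    backward n 0 ξ ≤ loynes ξ := by
  obtain ⟨N, hN, hn⟩ := ((eventually_backward_eq h le_rfl).and (eventually_ge_atTop n)).exists
  rw [← hN]
  exact monotone_nat_of_le_succ (backward_le_succ · ξ) hn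

/-- By the law of large numbers, a random walk with negative drift tends to `-∞`. -/
lemma ae_tendsto_sum_atBot (η : Measure ℝ) [IsProbabilityMeasure η]
    (hint : Integrable (fun x => x) η) (hneg : ∫ x, x ∂η < 0) :
    ∀ᵐ ξ ∂Measure.infinitePi fun _ : ℕ => η,
      Tendsto (fun n => ∑ i ∈ Finset.range n, ξ i) atTop atBot := by
  have hmp : ∀ i, MeasurePreserving (fun ξ : ℕ → ℝ => ξ i) (Measure.infinitePi fun _ : ℕ => η) η :=
    fun i => measurePreserving_eval_infinitePi (fun _ : ℕ => η) i
  have hslln := strong_law_ae_real (μ := Measure.infinitePi fun _ : ℕ => η)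
    (fun i ξ => ξ i) ((hmp 0).integrable_comp_of_integrable hint)
    (fun i j hij => (iIndepFun_infinitePi (P := fun _ : ℕ => η) (X := fun _ x => x)
      (fun _ => measurable_id)).indepFun hij)
    (fun i => ⟨(measurable_pi_apply i).aemeasurable, (measurable_pi_apply 0).aemeasurable,
      by rw [(hmp i).map_eq, (hmp 0).map_eq]⟩)
  have hmean : ∫ ξ : ℕ → ℝ, ξ 0 ∂Measure.infinitePi (fun _ : ℕ => η) = ∫ x, x ∂η := by
    rw [← (hmp 0).map_eq, integral_map (measurable_pi_apply 0).aemeasurable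
      (by fun_prop), (hmp 0).map_eq]
  filter_upwards [hslln] with ξ hξ
  rw [hmean] at hξ
  have := hξ.neg_mul_atTop hneg tendsto_natCast_atTop_atTop
  refine this.congr' ?_
  filter_upwards [eventually_gt_atTop 0] with n hn
  field_simp

/-- An M/GI/1-type Lindley recursion with negative drift has exactly one invariant law. It
dominates the laws of the recursion started from an empty queue in the usual stochastic order. -/
theorem exists_unique_lindley_invariant (η : Measure ℝ) [IsProbabilityMeasure η]
    (hint : Integrable (fun x => x) η) (hneg : ∫ x, x ∂η < 0) :
    ∃ ν : Measure ℝ, IsProbabilityMeasure ν ∧ lindleyStep η ν = ν ∧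
      (∀ ν' : Measure ℝ, IsProbabilityMeasure ν' → lindleyStep η ν' = ν' → ν' = ν) ∧
      ∀ (n : ℕ) (L : Set ℝ), IsLowerSet L →
        ν L ≤ (lindleyStep η)^[n] (Measure.dirac 0) L := by
  set Q := Measure.infinitePi fun _ : ℕ => η with hQ
  have hdrift := ae_tendsto_sum_atBot η hint hneg
  have hcons : MeasurePreserving _ (Q.prod η) Q := measurePreserving_cons η
  refine ⟨Q.map loynes, Measure.isProbabilityMeasure_map measurable_loynes.aemeasurable,
    ?_, ?_, ?_⟩
  · -- invariance: the limit satisfies the recursion along the shift of the increments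
    have hsplit : ∀ᵐ z ∂Q.prod η,
        loynes (fun n => Nat.casesOn n z.2 z.1) = max (loynes z.1 + z.2) 0 := by
      filter_upwards [hcons.quasiMeasurePreserving.ae hdrift,
        Measure.quasiMeasurePreserving_fst.ae hdrift] with z hz hz'
      obtain ⟨n, hn, hn'⟩ := (((tendsto_add_atTop_nat 1).eventually
        (eventually_backward_eq hz le_rfl)).and (eventually_backward_eq hz' le_rfl)).exists
      rw [← hn, ← hn']
      rfl
    have h1 : MeasurePreserving (fun z : (ℕ → ℝ) × ℝ => (loynes z.1, z.2)) (Q.prod η)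
        ((Q.map loynes).prod η) :=
      (measurable_loynes.measurePreserving Q).prod (MeasurePreserving.id η)
    rw [lindleyStep, ← h1.map_eq, Measure.map_map (by fun_prop) h1.measurable]
    conv_rhs => rw [← hcons.map_eq, Measure.map_map measurable_loynes hcons.measurable]
    refine Measure.map_congr ?_
    filter_upwards [hsplit] with z hz
    exact hz.symm
  · -- uniqueness: started from `ν'`, all backward iterates have the law `ν'`, whereas they are
    -- eventually equal to the limit
    intro ν' hν' hinv
    have hfix : ∀ n, (lindleyStep η)^[n] ν' = ν' := fun n =>
      Function.iterate_fixed hinv n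
    have hnonneg : ∀ᵐ w ∂ν', 0 ≤ w := by
      rw [← hinv, lindleyStep, ae_map_iff (by fun_prop) measurableSet_Ici]
      exact Eventually.of_forall fun z => le_max_right _ _
    have hae : ∀ᵐ z ∂ν'.prod Q, ∀ᶠ n in atTop, backward n z.1 z.2 = loynes z.2 := by
      filter_upwards [Measure.quasiMeasurePreserving_fst.ae hnonneg,
        Measure.quasiMeasurePreserving_snd.ae hdrift] with z hz hz'
      exact eventually_backward_eq hz' hz
    have hloy : (ν'.prod Q).map (fun z => loynes z.2) = Q.map loynes := by
      have := (measurable_loynes.measurePreserving Q).comp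
        (measurePreserving_snd (μ := ν') (ν := Q))
      exact this.map_eq
    rw [← hloy]
    refine Measure.ext fun B hB => ?_
    have hlim : Tendsto (fun n => ∫⁻ z, B.indicator 1 (backward n z.1 z.2) ∂ν'.prod Q) atTop
        (𝓝 (∫⁻ z, B.indicator 1 (loynes z.2) ∂ν'.prod Q)) := by
      refine tendsto_lintegral_of_dominated_convergence (fun _ => 1) (fun n => ?_)
        (fun n => Eventually.of_forall fun z => Set.indicator_le_self' (by simp) _) (by simp) ?_
      · exact (measurable_one.indicator hB).comp (measurable_backward n)
      · filter_upwards [hae] with z hz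
        exact tendsto_const_nhds.congr' (hz.mono fun n hn => by simp only [hn])
    have hconst : ∀ n, ∫⁻ z, B.indicator 1 (backward n z.1 z.2) ∂ν'.prod Q = ν' B := by
      intro n
      have hmp := measurePreserving_backward η ν' n
      rw [hfix n] at hmp
      rw [hmp.lintegral_comp (f := B.indicator 1) (measurable_one.indicator hB),
        lintegral_indicator_one hB]
    simp only [hconst] at hlim
    rw [tendsto_nhds_unique tendsto_const_nhds hlim,
      ← lintegral_indicator_one (μ := (ν'.prod Q).map _) hB,
      lintegral_map (f := B.indicator 1) (g := fun z : ℝ × (ℕ → ℝ) => loynes z.2)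
        (measurable_one.indicator hB) (measurable_loynes.comp measurable_snd)]
  · intro n L hL
    have hLm : MeasurableSet L := hL.ordConnected.measurableSet
    have hmp := measurePreserving_backward η (Measure.dirac 0) n
    rw [← hmp.measure_preimage hLm.nullMeasurableSet, Measure.map_apply measurable_loynes hLm,
      Measure.dirac_prod, Measure.map_apply (by fun_prop) (hmp.measurable hLm)]
    refine measure_mono_ae ?_
    filter_upwards [hdrift] with ξ hξ hmem
    exact hL (backward_le_loynes hξ n) hmem

/-! ### The workload chain with i.i.d. routing vectors -/

lemma lintegral_toMeasure {β : Type*} [Countable β] [MeasurableSpace β]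
    [MeasurableSingletonClass β] (q : PMF β) (f : β → ℝ≥0∞) :
    ∫⁻ r, f r ∂q.toMeasure = ∑' r, q r * f r := by
  rw [lintegral_countable']
  refine tsum_congr fun r => ?_
  rw [PMF.toMeasure_apply_singleton _ _ (measurableSet_singleton r), mul_comm]

/-- Workload vector seen by the next arrival, if the present one sees `w`, has the routing vector
`r`, and is followed by the interarrival time `t`. -/
def nextWorkload {m : ℕ} (c mu : ℝ) (w : Fin m → ℝ) (r : Fin m → ℕ) (t : ℝ) : Fin m → ℝ :=
  fun i => max (w i + c * (r i : ℝ) - mu * t) 0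

@[fun_prop]
lemma measurable_coord_cast {m : ℕ} (i : Fin m) :
    Measurable fun r : Fin m → ℕ => (r i : ℝ) := measurable_of_countable _

lemma measurable_nextWorkload {m : ℕ} (c mu : ℝ) :
    Measurable fun z : (Fin m → ℝ) × (Fin m → ℕ) × ℝ => nextWorkload c mu z.1 z.2.1 z.2.2 := by
  refine measurable_pi_iff.2 fun i => ?_
  have h : Measurable fun z : (Fin m → ℝ) × (Fin m → ℕ) × ℝ => (z.2.1 i : ℝ) :=
    (measurable_coord_cast i).comp (by fun_prop)
  exact ((((measurable_pi_apply i).comp measurable_fst).add (h.const_mul c)).sub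
    (by fun_prop)).max measurable_const

/-- Law of the workload vector seen by the next arrival, if the present one sees a workload vector
of law `M`, and the routing vector of law `q` and the interarrival time of law `E` are independent
of everything else. -/
def chainStep {m : ℕ} (c mu : ℝ) (q : PMF (Fin m → ℕ)) (E : Measure ℝ)
    (M : Measure (Fin m → ℝ)) : Measure (Fin m → ℝ) :=
  (M.prod (q.toMeasure.prod E)).map fun z => nextWorkload c mu z.1 z.2.1 z.2.2

lemma isProbabilityMeasure_chainStep {m : ℕ} (c mu : ℝ) (q : PMF (Fin m → ℕ)) (E : Measure ℝ)
    [IsProbabilityMeasure E] (M : Measure (Fin m → ℝ)) [IsProbabilityMeasure M] :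
    IsProbabilityMeasure (chainStep c mu q E M) :=
  Measure.isProbabilityMeasure_map (measurable_nextWorkload c mu).aemeasurable

lemma isProbabilityMeasure_iterate_chainStep {m : ℕ} (c mu : ℝ) (q : PMF (Fin m → ℕ))
    (E : Measure ℝ) [IsProbabilityMeasure E] (M : Measure (Fin m → ℝ))
    [hM : IsProbabilityMeasure M] (n : ℕ) :
    IsProbabilityMeasure ((chainStep c mu q E)^[n] M) := by
  induction n with
  | zero => exact hM
  | succ n ih =>
    rw [Function.iterate_succ_apply']
    exact isProbabilityMeasure_chainStep _ _ _ _ _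

/-- Law of the increment, between two arrivals and before reflection at zero, of the workload of
server `i`. -/
def incrementLaw {m : ℕ} (c mu : ℝ) (q : PMF (Fin m → ℕ)) (E : Measure ℝ) (i : Fin m) :
    Measure ℝ :=
  (q.toMeasure.prod E).map fun z => c * (z.1 i : ℝ) - mu * z.2

lemma measurable_increment {m : ℕ} (c mu : ℝ) (i : Fin m) :
    Measurable fun z : (Fin m → ℕ) × ℝ => c * (z.1 i : ℝ) - mu * z.2 :=
  (((measurable_coord_cast i).comp measurable_fst).const_mul c).sub (by fun_prop)

instance {m : ℕ} (c mu : ℝ) (q : PMF (Fin m → ℕ)) (E : Measure ℝ) [IsProbabilityMeasure E]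
    (i : Fin m) : IsProbabilityMeasure (incrementLaw c mu q E i) :=
  Measure.isProbabilityMeasure_map (measurable_increment c mu i).aemeasurable

/-- Each server on its own follows a Lindley recursion. -/
lemma map_eval_chainStep {m : ℕ} (c mu : ℝ) (q : PMF (Fin m → ℕ)) (E : Measure ℝ)
    [IsProbabilityMeasure E] (M : Measure (Fin m → ℝ)) [IsProbabilityMeasure M] (i : Fin m) :
    (chainStep c mu q E M).map (fun w => w i)
      = lindleyStep (incrementLaw c mu q E i) (M.map fun w => w i) := by
  have h : MeasurePreserving (fun z : (Fin m → ℝ) × (Fin m → ℕ) × ℝ =>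
      (z.1 i, c * (z.2.1 i : ℝ) - mu * z.2.2)) (M.prod (q.toMeasure.prod E))
      ((M.map fun w => w i).prod (incrementLaw c mu q E i)) :=
    ((measurable_pi_apply i).measurePreserving M).prod
      ((measurable_increment c mu i).measurePreserving _)
  rw [chainStep, lindleyStep,
    Measure.map_map (measurable_pi_apply i) (measurable_nextWorkload c mu), ← h.map_eq,
    Measure.map_map (by fun_prop) h.measurable]
  congr 1
  funext z
  simp [nextWorkload, add_sub_assoc]

lemma map_eval_iterate_chainStep {m : ℕ} (c mu : ℝ) (q : PMF (Fin m → ℕ)) (E : Measure ℝ)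
    [IsProbabilityMeasure E] (M : Measure (Fin m → ℝ)) [IsProbabilityMeasure M] (i : Fin m)
    (n : ℕ) :
    ((chainStep c mu q E)^[n] M).map (fun w => w i)
      = (lindleyStep (incrementLaw c mu q E i))^[n] (M.map fun w => w i) := by
  induction n with
  | zero => rfl
  | succ n ih =>
    have := isProbabilityMeasure_iterate_chainStep c mu q E M n
    rw [Function.iterate_succ_apply', Function.iterate_succ_apply', map_eval_chainStep, ih]

/-! ### Association -/

/-- Association of a law on `ℝ^m`, tested on antitone functions with values in `[0, 1]`. -/
def AssociatedLaw {m : ℕ} (M : Measure (Fin m → ℝ)) : Prop :=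
  ∀ f g : (Fin m → ℝ) → ℝ≥0∞, Antitone f → Antitone g → Measurable f → Measurable g →
    (∀ x, f x ≤ 1) → (∀ x, g x ≤ 1) →
    (∫⁻ x, f x ∂M) * (∫⁻ x, g x ∂M) ≤ ∫⁻ x, f x * g x ∂M

/-- Chebyshev's integral inequality: a real random variable is associated. -/
lemma lintegral_mul_lintegral_le_of_monotone (E : Measure ℝ) [IsProbabilityMeasure E]
    {f g : ℝ → ℝ≥0∞} (hf : Monotone f) (hg : Monotone g) :
    (∫⁻ t, f t ∂E) * (∫⁻ t, g t ∂E) ≤ ∫⁻ t, f t * g t ∂E := by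
  have hfm := hf.measurable
  have hgm := hg.measurable
  have hle : ∀ t u : ℝ, t ≤ u → f t * g u + f u * g t ≤ f t * g t + f u * g u := by
    intro t u h
    obtain ⟨d, hd⟩ := exists_add_of_le (hf h)
    obtain ⟨e, he⟩ := exists_add_of_le (hg h)
    calc f t * g u + f u * g t ≤ f t * g u + f u * g t + d * e := le_self_add
      _ = f t * g t + f u * g u := by rw [hd, he]; ring
  have hpt : ∀ t u : ℝ, f t * g u + f u * g t ≤ f t * g t + f u * g u := by
    intro t u
    rcases le_total t u with h | h
    · exact hle t u h
    · have := hle u t h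
      rwa [add_comm, add_comm (f t * g t)]
  have hint : ∫⁻ t, ∫⁻ u, f t * g u + f u * g t ∂E ∂E
      ≤ ∫⁻ t, ∫⁻ u, f t * g t + f u * g u ∂E ∂E :=
    lintegral_mono fun t => lintegral_mono fun u => hpt t u
  have h1 : ∫⁻ t, ∫⁻ u, f t * g u + f u * g t ∂E ∂E
      = 2 * ((∫⁻ t, f t ∂E) * (∫⁻ t, g t ∂E)) := by
    simp_rw [fun t => lintegral_add_left (μ := E) (hgm.const_mul (f t)) fun u => f u * g t,
      lintegral_const_mul _ hgm, lintegral_mul_const _ hfm]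
    rw [lintegral_add_left (hfm.mul_const _), lintegral_mul_const _ hfm, lintegral_const_mul _ hgm,
      two_mul]
  have h2 : ∫⁻ t, ∫⁻ u, f t * g t + f u * g u ∂E ∂E = 2 * ∫⁻ t, f t * g t ∂E := by
    simp_rw [fun t => lintegral_add_left (μ := E) (measurable_const (a := f t * g t))
      fun u => f u * g u]
    rw [lintegral_add_right _ measurable_const]
    simp [two_mul]
  rw [h1, h2] at hint
  exact (ENNReal.mul_le_mul_iff_right (by simp) (by simp)).1 hint

/-- An associated routing vector satisfies the association inequality for antitone functions with
values in `[0, 1]`. -/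
lemma IsAssociated.lintegral_mul_le {m : ℕ} {q : PMF (Fin m → ℕ)}
    (h : IsAssociated (fun (s : Fin m → ℕ) i => (s i : ℝ)) q.toMeasure)
    {f g : (Fin m → ℝ) → ℝ≥0∞} (hf : Antitone f) (hg : Antitone g)
    (hf1 : ∀ x, f x ≤ 1) (hg1 : ∀ x, g x ≤ 1) :
    (∫⁻ r, f (fun i => (r i : ℝ)) ∂q.toMeasure) * (∫⁻ r, g (fun i => (r i : ℝ)) ∂q.toMeasure)
      ≤ ∫⁻ r, f (fun i => (r i : ℝ)) * g (fun i => (r i : ℝ)) ∂q.toMeasure := by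
  have hint : ∀ u : (Fin m → ℕ) → ℝ≥0∞, (∀ r, u r ≤ 1) →
      Integrable (fun r => (u r).toReal) q.toMeasure := fun u hu =>
    Integrable.of_bound (measurable_of_countable _).aestronglyMeasurable 1
      (Eventually.of_forall fun r => by
        rw [Real.norm_of_nonneg ENNReal.toReal_nonneg]
        exact ENNReal.toReal_le_of_le_ofReal zero_le_one (by simpa using hu r))
  have hfg1 : ∀ x, f x * g x ≤ 1 := fun x => mul_le_one' (hf1 x) (hg1 x)
  have hne : ∀ u : (Fin m → ℝ) → ℝ≥0∞, (∀ r, u r ≤ 1) → ∀ r, u r ≠ ∞ := fun u hu r =>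
    ((hu r).trans_lt ENNReal.one_lt_top).ne
  -- the hypothesis concerns monotone functions, so it is applied to `-f` and `-g`
  have key := h (fun x => -(f x).toReal) (fun x => -(g x).toReal)
    (fun x y hxy => neg_le_neg (ENNReal.toReal_mono (hne f hf1 x) (hf hxy)))
    (fun x y hxy => neg_le_neg (ENNReal.toReal_mono (hne g hg1 x) (hg hxy)))
    (hint _ fun r => hf1 _).neg (hint _ fun r => hg1 _).neg
    (by simpa [ENNReal.toReal_mul] using hint _ fun r => hfg1 fun i => (r i : ℝ))
  simp only [integral_neg, neg_mul_neg, ← ENNReal.toReal_mul] at key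
  have hlt : ∀ u : (Fin m → ℕ) → ℝ≥0∞, (∀ r, u r ≤ 1) → ∫⁻ r, u r ∂q.toMeasure ≠ ∞ := fun u hu =>
    ((lintegral_mono hu).trans_lt (by simp)).ne
  have htr : ∀ u : (Fin m → ℕ) → ℝ≥0∞, (∀ r, u r ≤ 1) →
      ∫ r, (u r).toReal ∂q.toMeasure = (∫⁻ r, u r ∂q.toMeasure).toReal := fun u hu =>
    integral_toReal (measurable_of_countable _).aemeasurable
      (Eventually.of_forall fun r => (hu r).trans_lt ENNReal.one_lt_top)
  rw [htr _ fun r => hf1 _, htr _ fun r => hg1 _, htr _ fun r => hfg1 _,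
    ← ENNReal.toReal_mul] at key
  exact (ENNReal.toReal_le_toReal (ENNReal.mul_ne_top (hlt _ fun r => hf1 _)
    (hlt _ fun r => hg1 _)) (hlt _ fun r => hfg1 _)).1 key

/-- One step of the chain, as an iterated integral with the interarrival time outermost. -/
lemma lintegral_chainStep_swap {m : ℕ} (c mu : ℝ) (q : PMF (Fin m → ℕ)) (E : Measure ℝ)
    [IsProbabilityMeasure E] (M : Measure (Fin m → ℝ)) [IsProbabilityMeasure M]
    {f : (Fin m → ℝ) → ℝ≥0∞} (hf : Measurable f) :
    ∫⁻ x, f x ∂chainStep c mu q E M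
      = ∫⁻ t, ∫⁻ w, ∫⁻ r, f (nextWorkload c mu w r t) ∂q.toMeasure ∂M ∂E := by
  have hF : Measurable fun z : (Fin m → ℝ) × (Fin m → ℕ) × ℝ =>
    f (nextWorkload c mu z.1 z.2.1 z.2.2) := hf.comp (measurable_nextWorkload c mu)
  rw [chainStep, lintegral_map hf (measurable_nextWorkload c mu), lintegral_prod _ hF.aemeasurable]
  have h1 : ∀ w, ∫⁻ y, f (nextWorkload c mu w y.1 y.2) ∂q.toMeasure.prod E
      = ∫⁻ t, ∫⁻ r, f (nextWorkload c mu w r t) ∂q.toMeasure ∂E := fun w =>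
    lintegral_prod_symm' _ (hF.comp measurable_prodMk_left)
  simp only [h1]
  refine lintegral_lintegral_swap ?_
  have : Measurable fun z : ((Fin m → ℝ) × ℝ) × (Fin m → ℕ) =>
      f (nextWorkload c mu z.1.1 z.2 z.1.2) :=
    hF.comp (f := fun z : ((Fin m → ℝ) × ℝ) × (Fin m → ℕ) => (z.1.1, z.2, z.1.2)) (by fun_prop)
  exact this.lintegral_prod_right'.aemeasurable

lemma nextWorkload_mono {m : ℕ} {c mu : ℝ} {w w' : Fin m → ℝ}
    (hw : w ≤ w') (r : Fin m → ℕ) (t : ℝ) :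
    nextWorkload c mu w r t ≤ nextWorkload c mu w' r t := fun i =>
  max_le_max (by have := hw i; linarith) le_rfl

lemma nextWorkload_anti {m : ℕ} {c mu : ℝ} (hmu : 0 ≤ mu) (w : Fin m → ℝ)
    (r : Fin m → ℕ) {t t' : ℝ} (h : t ≤ t') :
    nextWorkload c mu w r t' ≤ nextWorkload c mu w r t := fun i =>
  max_le_max (by have := mul_le_mul_of_nonneg_left h hmu; linarith) le_rfl

/-- Associated routing vectors preserve association of the workload vector: the workload is a
monotone function of three independent associated quantities, namely the previous workload, the
routing vector, and minus the interarrival time. -/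
lemma AssociatedLaw.chainStep {m : ℕ} {c mu : ℝ} (hc : 0 ≤ c) (hmu : 0 ≤ mu)
    {q : PMF (Fin m → ℕ)}
    (hq : IsAssociated (fun (s : Fin m → ℕ) i => (s i : ℝ)) q.toMeasure) (E : Measure ℝ)
    [IsProbabilityMeasure E] {M : Measure (Fin m → ℝ)} [IsProbabilityMeasure M]
    (hM : AssociatedLaw M) : AssociatedLaw (chainStep c mu q E M) := by
  intro f g hf hg hfm hgm hf1 hg1
  have hmeas : ∀ u : (Fin m → ℝ) → ℝ≥0∞, Measurable u → ∀ t,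
      Measurable fun w => ∫⁻ r, u (nextWorkload c mu w r t) ∂q.toMeasure := by
    intro u hu t
    have : Measurable fun z : (Fin m → ℝ) × (Fin m → ℕ) => u (nextWorkload c mu z.1 z.2 t) :=
      (hu.comp (measurable_nextWorkload c mu)).comp
        (f := fun z : (Fin m → ℝ) × (Fin m → ℕ) => (z.1, z.2, t)) (by fun_prop)
    exact this.lintegral_prod_right'
  have hanti : ∀ u : (Fin m → ℝ) → ℝ≥0∞, Antitone u → ∀ t,
      Antitone fun w => ∫⁻ r, u (nextWorkload c mu w r t) ∂q.toMeasure := fun u hu t w w' h =>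
    lintegral_mono fun r => hu (nextWorkload_mono h r t)
  have hle : ∀ u : (Fin m → ℝ) → ℝ≥0∞, (∀ x, u x ≤ 1) → ∀ t w,
      ∫⁻ r, u (nextWorkload c mu w r t) ∂q.toMeasure ≤ 1 := fun u hu t w =>
    (lintegral_mono fun r => hu _).trans (by simp)
  have hcast : ∀ u : (Fin m → ℝ) → ℝ≥0∞, Antitone u → ∀ (w : Fin m → ℝ) (t : ℝ),
      Antitone fun x : Fin m → ℝ => u fun i => max (w i + c * x i - mu * t) 0 :=
    fun u hu w t x y hxy => hu fun i =>
      max_le_max (by have := mul_le_mul_of_nonneg_left (hxy i) hc; linarith) le_rfl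
  have hmono : ∀ u : (Fin m → ℝ) → ℝ≥0∞, Antitone u →
      Monotone fun t => ∫⁻ w, ∫⁻ r, u (nextWorkload c mu w r t) ∂q.toMeasure ∂M :=
    fun u hu t t' h => lintegral_mono fun w => lintegral_mono fun r =>
      hu (nextWorkload_anti hmu w r h)
  rw [lintegral_chainStep_swap _ _ _ _ _ hfm, lintegral_chainStep_swap _ _ _ _ _ hgm,
    lintegral_chainStep_swap (f := fun x => f x * g x) _ _ _ _ _ (hfm.mul hgm)]
  -- the interarrival time, the previous workload and the routing vector are treated in this order
  refine (lintegral_mul_lintegral_le_of_monotone E (hmono f hf) (hmono g hg)).trans ?_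
  refine lintegral_mono fun t => ?_
  refine (hM _ _ (hanti f hf t) (hanti g hg t) (hmeas f hfm t) (hmeas g hgm t) (hle f hf1 t)
    (hle g hg1 t)).trans ?_
  exact lintegral_mono fun w => hq.lintegral_mul_le (hcast f hf w t) (hcast g hg w t)
    (fun x => hf1 _) fun x => hg1 _

lemma associatedLaw_dirac {m : ℕ} (x : Fin m → ℝ) : AssociatedLaw (Measure.dirac x) := by
  intro f g _ _ hf hg _ _
  rw [lintegral_dirac' _ hf, lintegral_dirac' _ hg,
    lintegral_dirac' (f := fun x => f x * g x) _ (hf.mul hg)]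

lemma associatedLaw_iterate_chainStep {m : ℕ} {c mu : ℝ} (hc : 0 ≤ c) (hmu : 0 ≤ mu)
    {q : PMF (Fin m → ℕ)}
    (hq : IsAssociated (fun (s : Fin m → ℕ) i => (s i : ℝ)) q.toMeasure) (E : Measure ℝ)
    [IsProbabilityMeasure E] (n : ℕ) :
    AssociatedLaw ((chainStep c mu q E)^[n] (Measure.dirac 0)) := by
  induction n with
  | zero => exact associatedLaw_dirac 0
  | succ n ih =>
    have := isProbabilityMeasure_iterate_chainStep c mu q E (Measure.dirac (0 : Fin m → ℝ)) n
    rw [Function.iterate_succ_apply']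
    exact ih.chainStep hc hmu hq E

/-- Association gives positive lower orthant dependence. -/
lemma AssociatedLaw.prod_le {m : ℕ} {M : Measure (Fin m → ℝ)} [IsProbabilityMeasure M]
    (hM : AssociatedLaw M) (A : Finset (Fin m)) {L : Fin m → Set ℝ}
    (hL : ∀ i, IsLowerSet (L i)) :
    ∏ i ∈ A, M {w | w i ∈ L i} ≤ M {w | ∀ i ∈ A, w i ∈ L i} := by
  classical
  have hLm : ∀ i, MeasurableSet (L i) := fun i => (hL i).ordConnected.measurableSet
  have hind : ∀ S : Set (Fin m → ℝ), IsLowerSet S →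
      Antitone (S.indicator (1 : (Fin m → ℝ) → ℝ≥0∞)) := by
    intro S hS x y hxy
    by_cases hy : y ∈ S
    · simp [hy, hS hxy hy]
    · simp [hy]
  have hle : ∀ (S : Set (Fin m → ℝ)) x, S.indicator (1 : (Fin m → ℝ) → ℝ≥0∞) x ≤ 1 := fun S x =>
    Set.indicator_le_self' (by simp) x
  induction A using Finset.induction_on with
  | empty => simp
  | insert a A ha ih =>
    rw [Finset.prod_insert ha]
    refine (mul_le_mul_right ih _).trans ?_
    have h1 : MeasurableSet {w : Fin m → ℝ | w a ∈ L a} := measurable_pi_apply a (hLm a)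
    have h2 : MeasurableSet {w : Fin m → ℝ | ∀ i ∈ A, w i ∈ L i} := by
      have : {w : Fin m → ℝ | ∀ i ∈ A, w i ∈ L i} = ⋂ i ∈ A, {w | w i ∈ L i} := by ext; simp
      rw [this]
      exact Finset.measurableSet_biInter A fun i _ => measurable_pi_apply i (hLm i)
    have key := hM _ _ (hind {w | w a ∈ L a} fun x y hxy hx => hL a (hxy a) hx)
      (hind {w | ∀ i ∈ A, w i ∈ L i} fun x y hxy hx i hi => hL i (hxy i) (hx i hi))
      (measurable_one.indicator h1) (measurable_one.indicator h2) (hle _) (hle _)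
    rw [lintegral_indicator_one h1, lintegral_indicator_one h2] at key
    refine key.trans (le_of_eq ?_)
    rw [← lintegral_indicator_one]
    · refine lintegral_congr fun w => ?_
      by_cases hw1 : w a ∈ L a <;> by_cases hw2 : ∀ i ∈ A, w i ∈ L i <;>
        simp [Set.indicator_apply, hw1, hw2]
    · have : {w : Fin m → ℝ | ∀ i ∈ insert a A, w i ∈ L i}
          = {w | w a ∈ L a} ∩ {w | ∀ i ∈ A, w i ∈ L i} := by ext; simp
      rw [this]
      exact h1.inter h2

/-! ### Stochastic domination of the delay by independent stationary workloads -/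

/-- The usual stochastic order, expressed by lower sets, implies the comparison of expectations of
monotone functions. -/
lemma lintegral_le_of_lowerSet {X : Type*} [MeasurableSpace X] (M N : Measure X)
    [IsProbabilityMeasure M] [IsProbabilityMeasure N] {f : X → ℝ} (hf : Measurable f)
    (h : ∀ L : Set ℝ, IsLowerSet L → N (f ⁻¹' L) ≤ M (f ⁻¹' L)) {g : ℝ → ℝ} (hg : Monotone g) :
    ∫⁻ x, ENNReal.ofReal (g (f x)) ∂M ≤ ∫⁻ x, ENNReal.ofReal (g (f x)) ∂N := by
  have hmeas : Measurable fun x => max (g (f x)) 0 := (hg.measurable.comp hf).max measurable_const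
  have hrepr : ∀ x, ENNReal.ofReal (g (f x)) = ENNReal.ofReal (max (g (f x)) 0) := fun x => by
    simp [ENNReal.ofReal_max]
  simp_rw [hrepr]
  have hpos : ∀ x, (0 : X → ℝ) x ≤ max (g (f x)) 0 := fun x => le_max_right _ _
  rw [lintegral_eq_lintegral_meas_lt M (Eventually.of_forall hpos) hmeas.aemeasurable,
    lintegral_eq_lintegral_meas_lt N (Eventually.of_forall hpos) hmeas.aemeasurable]
  refine lintegral_mono fun t => ?_
  have hset : {x | t < max (g (f x)) 0} = (f ⁻¹' {y | max (g y) 0 ≤ t})ᶜ := by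
    ext x; exact (not_le (a := max (g (f x)) 0)).symm
  have hlow : IsLowerSet {y | max (g y) 0 ≤ t} := fun y z hyz hy =>
    (max_le_max (hg hyz) le_rfl).trans hy
  have hm : MeasurableSet (f ⁻¹' {y | max (g y) 0 ≤ t}) := hf hlow.ordConnected.measurableSet
  simp only [hset]
  rw [prob_compl_eq_one_sub hm, prob_compl_eq_one_sub hm]
  exact tsub_le_tsub_left (h _ hlow) _

lemma measurable_delay {m : ℕ} (c : ℝ) (r : Fin m → ℕ) :
    Measurable fun w : Fin m → ℝ => delay c w r :=
  Measurable.iSup fun i => by fun_prop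

lemma delay_mem_lowerSet_iff {m : ℕ} (c : ℝ) (w : Fin m → ℝ) {r : Fin m → ℕ}
    (hr : ∃ i, 0 < r i) {L : Set ℝ} (hL : IsLowerSet L) :
    delay c w r ∈ L ↔ ∀ i, 0 < r i → w i + c * (r i : ℝ) ∈ L := by
  have : Nonempty {i : Fin m // 0 < r i} := let ⟨i, hi⟩ := hr; ⟨⟨i, hi⟩⟩
  constructor
  · intro h i hi
    exact hL (le_ciSup (f := fun i : {i : Fin m // 0 < r i} => w i + c * (r i : ℝ))
      (Set.finite_range _).bddAbove ⟨i, hi⟩) h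
  · intro h
    obtain ⟨j, hj⟩ := exists_eq_ciSup_of_finite
      (f := fun i : {i : Fin m // 0 < r i} => w i + c * (r i : ℝ))
    rw [delay, ← hj]
    exact h j j.2

lemma delay_of_forall_eq_zero {m : ℕ} (c : ℝ) (w : Fin m → ℝ) {r : Fin m → ℕ}
    (hr : ¬ ∃ i, 0 < r i) : delay c w r = 0 := by
  have : IsEmpty {i : Fin m // 0 < r i} := ⟨fun i => hr ⟨i, i.2⟩⟩
  exact Real.iSup_of_isEmpty _

/-- If the servers have associated workloads, each of which is stochastically smaller than `ν`,
then the delay is stochastically smaller than with independent workloads of law `ν`. -/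
lemma AssociatedLaw.lintegral_delay_le {m : ℕ} {M : Measure (Fin m → ℝ)}
    [IsProbabilityMeasure M] (hM : AssociatedLaw M) {ν : Measure ℝ} [IsProbabilityMeasure ν]
    (hν : ∀ i (L : Set ℝ), IsLowerSet L → ν L ≤ M {w | w i ∈ L}) (c : ℝ) (r : Fin m → ℕ)
    {g : ℝ → ℝ} (hg : Monotone g) :
    ∫⁻ w, ENNReal.ofReal (g (delay c w r)) ∂M
      ≤ ∫⁻ w, ENNReal.ofReal (g (delay c w r)) ∂Measure.pi fun _ => ν := by
  by_cases hr : ∃ i, 0 < r i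
  · refine lintegral_le_of_lowerSet _ _ (measurable_delay c r) (fun L hL => ?_) hg
    let A : Finset (Fin m) := Finset.univ.filter fun i => 0 < r i
    let L' : Fin m → Set ℝ := fun i => {x | x + c * (r i : ℝ) ∈ L}
    have hL' : ∀ i, IsLowerSet (L' i) := fun i x y hxy hx =>
      hL (add_le_add_left hxy (c * (r i : ℝ))) hx
    have hset : (fun w => delay c w r) ⁻¹' L = {w | ∀ i ∈ A, w i ∈ L' i} := by
      ext w
      simp [A, L', delay_mem_lowerSet_iff c w hr hL]
    have hpi : (Measure.pi fun _ => ν) {w : Fin m → ℝ | ∀ i ∈ A, w i ∈ L' i}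
        = ∏ i ∈ A, ν (L' i) := by
      classical
      have : {w : Fin m → ℝ | ∀ i ∈ A, w i ∈ L' i}
          = Set.pi Set.univ fun i => if i ∈ A then L' i else Set.univ := by
        ext w
        simp only [Set.mem_ofPred_eq, Set.mem_pi, Set.mem_univ, true_implies]
        refine forall_congr' fun i => ?_
        by_cases hi : i ∈ A <;> simp [hi]
      rw [this, Measure.pi_pi, ← Finset.prod_subset (Finset.subset_univ A)]
      · exact Finset.prod_congr rfl fun i hi => by simp [hi]
      · intro i _ hi
        simp [hi]
    rw [hset, hpi]
    exact (Finset.prod_le_prod' fun i _ => hν i _ (hL' i)).trans (hM.prod_le A hL')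
  · simp [delay_of_forall_eq_zero c _ hr]

/-! ### Greedy routing -/

/-- A cost of routing vectors which does not increase if one block is requested from a server with
a smaller updated workload instead. -/
def TransferMonotone {m : ℕ} (c : ℝ) (w : Fin m → ℝ) (Φ : (Fin m → ℕ) → ℝ≥0∞) : Prop :=
  ∀ (s : Fin m → ℕ) (i j : Fin m), w j + c * (s j : ℝ) ≤ w i + c * (s i : ℝ) →
    Φ (s + Pi.single j 1) ≤ Φ (s + Pi.single i 1)

/-- `GreedyReach c w b v₀ l v`: starting from `v₀`, the vector `v` arises from `l` steps, each of
which requests one block from a server with least updated workload among those whose capacity `b`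
is not exhausted. -/
inductive GreedyReach {m : ℕ} (c : ℝ) (w : Fin m → ℝ) (b v₀ : Fin m → ℕ) :
    ℕ → (Fin m → ℕ) → Prop
  | zero : GreedyReach c w b v₀ 0 v₀
  | succ {l : ℕ} {v : Fin m → ℕ} (j : Fin m) (h : GreedyReach c w b v₀ l v) (hj : v j < b j)
      (hmin : ∀ i, v i < b i → w j + c * (v j : ℝ) ≤ w i + c * (v i : ℝ)) :
      GreedyReach c w b v₀ (l + 1) (v + Pi.single j 1)

lemma sum_add_single {m : ℕ} (v : Fin m → ℕ) (j : Fin m) :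
    ∑ i, (v + Pi.single j 1 : Fin m → ℕ) i = ∑ i, v i + 1 := by
  simp [Finset.sum_add_distrib]

lemma add_single_le {m : ℕ} {v b : Fin m → ℕ} {j : Fin m} (hv : v ≤ b) (hj : v j < b j) :
    v + Pi.single j 1 ≤ b := by
  intro i
  rcases eq_or_ne i j with rfl | h
  · simpa using hj
  · simpa [h] using hv i

namespace GreedyReach

variable {m : ℕ} {c : ℝ} {w : Fin m → ℝ} {b v₀ : Fin m → ℕ} {l : ℕ} {v : Fin m → ℕ}

lemma sum_eq (h : GreedyReach c w b v₀ l v) : ∑ i, v i = ∑ i, v₀ i + l := by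
  induction h with
  | zero => rfl
  | succ j _ _ _ ih => rw [sum_add_single, ih, add_assoc]

lemma le_left (h : GreedyReach c w b v₀ l v) : v₀ ≤ v := by
  induction h with
  | zero => exact le_rfl
  | succ j _ _ _ ih => exact ih.trans (le_add_of_nonneg_right (by positivity))

lemma le_right (h : GreedyReach c w b v₀ l v) (h₀ : v₀ ≤ b) : v ≤ b := by
  induction h with
  | zero => exact h₀
  | succ j _ hj _ ih => exact add_single_le ih hj

/-- Exchange argument: any competitor can be modified so as to dominate the greedy vector, without
an increase of its cost. If the block chosen next by the greedy algorithm is missing from the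
competitor, it replaces some block that the greedy algorithm has not chosen so far. -/
lemma exists_dominating (hc : 0 ≤ c) (h : GreedyReach c w b v₀ l v) {Φ : (Fin m → ℕ) → ℝ≥0∞}
    (hΦ : TransferMonotone c w Φ) {s : Fin m → ℕ} (h₀ : v₀ ≤ s) (hs : s ≤ b)
    (hsum : ∑ i, v i ≤ ∑ i, s i) :
    ∃ s', v ≤ s' ∧ s' ≤ b ∧ ∑ i, s' i = ∑ i, s i ∧ Φ s' ≤ Φ s := by
  induction h with
  | zero => exact ⟨s, h₀, hs, rfl, le_rfl⟩
  | @succ l v j _ hj hmin ih =>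
    rw [sum_add_single] at hsum
    obtain ⟨s', hv, hb, hsum', hΦ'⟩ := ih (by omega)
    by_cases hjs : v j < s' j
    · exact ⟨s', add_single_le hv hjs, hb, hsum', hΦ'⟩
    obtain ⟨i, -, hi⟩ : ∃ i ∈ Finset.univ, v i < s' i :=
      Finset.exists_lt_of_sum_lt (by omega)
    have hij : j ≠ i := fun h => hjs (h ▸ hi)
    obtain ⟨u, rfl⟩ : ∃ u : Fin m → ℕ, s' = u + Pi.single i 1 := by
      refine ⟨s' - Pi.single i 1, funext fun k => ?_⟩
      rcases eq_or_ne k i with rfl | hk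
      · simp; omega
      · simp [hk]
    have hui : v i ≤ u i := by simpa [Nat.lt_succ_iff] using hi
    have huj : u j = v j := le_antisymm (by simpa [hij] using hjs) (by simpa [hij] using hv j)
    have hvu : v ≤ u := fun k => by
      rcases eq_or_ne k i with rfl | hk
      · exact hui
      · simpa [hk] using hv k
    have hub : u ≤ b := fun k => le_trans (by simp) (hb k)
    refine ⟨u + Pi.single j 1, add_le_add_left hvu _, add_single_le hub (huj ▸ hj), ?_,
      (hΦ u i j ?_).trans hΦ'⟩
    · rw [← hsum', sum_add_single, sum_add_single]
    · have hvi : v i < b i := lt_of_le_of_lt hui (by have := hb i; simp at this; omega)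
      have := mul_le_mul_of_nonneg_left (Nat.cast_le (α := ℝ).2 hui) hc
      rw [huj]
      linarith [hmin i hvi]

/-- The greedy vector has the least cost among all feasible vectors with the same number of
blocks. -/
lemma cost_le (hc : 0 ≤ c) (h : GreedyReach c w b v₀ l v) {Φ : (Fin m → ℕ) → ℝ≥0∞}
    (hΦ : TransferMonotone c w Φ) {s : Fin m → ℕ} (h₀ : v₀ ≤ s) (hs : s ≤ b)
    (hsum : ∑ i, s i = ∑ i, v₀ i + l) : Φ v ≤ Φ s := by
  obtain ⟨s', hv, -, hsum', hΦ'⟩ := h.exists_dominating hc hΦ h₀ hs (by rw [h.sum_eq, hsum])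
  have : v = s' := by
    by_contra hne
    obtain ⟨i, hi⟩ := Function.ne_iff.1 hne
    have := Finset.sum_lt_sum (fun i _ => hv i) ⟨i, Finset.mem_univ i, lt_of_le_of_ne (hv i) hi⟩
    rw [h.sum_eq, hsum', hsum] at this
    exact lt_irrefl _ this
  rwa [this]

lemma exists_lt (h : GreedyReach c w b v₀ l v) (hl : ∑ i, v₀ i + (l + 1) ≤ ∑ i, b i) :
    ∃ i, v i < b i := by
  obtain ⟨i, -, hi⟩ : ∃ i ∈ Finset.univ, v i < b i :=
    Finset.exists_lt_of_sum_lt (by rw [h.sum_eq]; omega)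
  exact ⟨i, hi⟩

end GreedyReach

lemma mem_support_uniformOr {β : Type*} {S : Finset β} (hS : S.Nonempty) (d x : β) :
    x ∈ (uniformOr S d).support ↔ x ∈ S := by
  rw [uniformOr, dif_pos hS, PMF.mem_support_uniformOfFinset_iff]

lemma argminServers_nonempty {m : ℕ} {S : Finset (Fin m)} (hS : S.Nonempty) (v : Fin m → ℝ) :
    (argminServers S v).Nonempty := by
  classical
  obtain ⟨i, hi, hmin⟩ := S.exists_min_image v hS
  exact ⟨i, by simpa [argminServers, hi] using hmin⟩

lemma exists_of_mem_support_addBlock {m : ℕ} {S : Finset (Fin m)} (hS : S.Nonempty)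
    (v : Fin m → ℝ) {s r : Fin m → ℕ} (h : r ∈ (addBlock (argminServers S v) s).support) :
    ∃ j ∈ S, (∀ i ∈ S, v j ≤ v i) ∧ r = s + Pi.single j 1 := by
  classical
  rw [addBlock, mem_support_uniformOr ((argminServers_nonempty hS v).image _),
    Finset.mem_image] at h
  obtain ⟨j, hj, rfl⟩ := h
  simp only [argminServers, Finset.mem_filter] at hj
  exact ⟨j, hj.1, hj.2, rfl⟩

lemma greedyReach_waterFilling {m : ℕ} {c : ℝ} {a : Fin m → ℕ} {w : Fin m → ℝ} {l : ℕ}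
    (hl : l ≤ ∑ i, a i) {r : Fin m → ℕ} (h : r ∈ (waterFilling c a w l).support) :
    GreedyReach c w a 0 l r := by
  induction l generalizing r with
  | zero =>
    simp only [waterFilling, PMF.support_pure, Set.mem_singleton_iff] at h
    exact h ▸ GreedyReach.zero
  | succ l ih =>
    rw [waterFilling, PMF.mem_support_bind_iff] at h
    obtain ⟨v, hv, hr⟩ := h
    have hreach := ih (by omega) hv
    obtain ⟨i, hi⟩ := hreach.exists_lt (by simpa using hl)
    obtain ⟨j, hj, hmin, rfl⟩ := exists_of_mem_support_addBlock ⟨i, by simpa using hi⟩ _ hr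
    exact hreach.succ j (by simpa using hj) fun i hi => hmin i (by simpa using hi)

/-- Capacities under batch sampling: at most one block in addition to `q` blocks per server. -/
def batchCapacity {m : ℕ} (q : ℕ) (a : Fin m → ℕ) : Fin m → ℕ :=
  fun i => q + if q < a i then 1 else 0

lemma sum_batchCapacity {m : ℕ} (q : ℕ) (a : Fin m → ℕ) :
    ∑ i, batchCapacity q a i = m * q + (Finset.univ.filter fun i => q < a i).card := by
  simp [batchCapacity, Finset.sum_add_distrib]

lemma greedyReach_batchSamplingSteps {m : ℕ} {c : ℝ} {q : ℕ} {a : Fin m → ℕ} {w : Fin m → ℝ}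
    {l : ℕ} (hl : l ≤ (Finset.univ.filter fun i => q < a i).card) {r : Fin m → ℕ}
    (h : r ∈ (batchSamplingSteps q a w l).support) :
    GreedyReach c w (batchCapacity q a) (fun _ => q) l r := by
  induction l generalizing r with
  | zero =>
    simp only [batchSamplingSteps, PMF.support_pure, Set.mem_singleton_iff] at h
    exact h ▸ GreedyReach.zero
  | succ l ih =>
    rw [batchSamplingSteps, PMF.mem_support_bind_iff] at h
    obtain ⟨v, hv, hr⟩ := h
    have hreach := ih (by omega) hv
    have hq : ∀ i, q ≤ v i := hreach.le_left
    have hfree : ∀ i, v i < batchCapacity q a i ↔ q < a i ∧ v i = q := by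
      intro i
      have := hq i
      have := hreach.le_right (fun i => by simp [batchCapacity]) i
      by_cases h : q < a i <;> simp only [batchCapacity, h, if_true, if_false] at this ⊢ <;>
        simp <;> omega
    obtain ⟨i, hi⟩ := hreach.exists_lt (by rw [sum_batchCapacity]; simpa using hl)
    obtain ⟨j, hj, hmin, rfl⟩ := exists_of_mem_support_addBlock
      ⟨i, by simpa using (hfree i).1 hi⟩ _ hr
    have hj' : q < a j ∧ v j = q := by simpa using hj
    refine hreach.succ j ((hfree j).2 hj') fun i hi => ?_
    have hi' := (hfree i).1 hi
    rw [hj'.2, hi'.2]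
    linarith [hmin i (by simpa using hi')]

/-! ### Feasibility of the balanced random policy -/

lemma sum_balancedVec {m : ℕ} (q : ℕ) (S : Finset (Fin m)) :
    ∑ i, balancedVec q S i = m * q + S.card := by
  classical
  simp [balancedVec, Finset.sum_add_distrib]

lemma exists_of_mem_support_placementLaw {m αk : ℕ} (hm : 0 < m) {a : Fin m → ℕ}
    (h : a ∈ (placementLaw m αk).support) :
    ∃ S : Finset (Fin m), S.card = αk % m ∧ a = balancedVec (αk / m) S := by
  rw [placementLaw, PMF.mem_support_map_iff] at h
  obtain ⟨S, hS, rfl⟩ := h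
  have hne : (Finset.powersetCard (αk % m) (Finset.univ : Finset (Fin m))).Nonempty :=
    Finset.powersetCard_nonempty.2 (by simpa using (Nat.mod_lt αk hm).le)
  rw [mem_support_uniformOr hne, Finset.mem_powersetCard] at hS
  exact ⟨S, hS.2, rfl⟩

/-- The facts about a placement vector that make all three policies feasible. -/
lemma placement_feasible {m k αk : ℕ} (hm : 0 < m) (hk : k ≤ αk) {a : Fin m → ℕ}
    (h : a ∈ (placementLaw m αk).support) :
    k ≤ ∑ i, a i ∧ (∀ i, k / m ≤ a i) ∧
      k % m ≤ (Finset.univ.filter fun i => k / m < a i).card := by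
  classical
  obtain ⟨S, hS, rfl⟩ := exists_of_mem_support_placementLaw hm h
  have hdiv : k / m ≤ αk / m := Nat.div_le_div_right hk
  refine ⟨?_, fun i => hdiv.trans (Nat.le_add_right _ _), ?_⟩
  · rw [sum_balancedVec, hS, Nat.div_add_mod]
    exact hk
  · rcases hdiv.lt_or_eq with hlt | heq
    · have : (Finset.univ.filter fun i : Fin m => k / m < balancedVec (αk / m) S i) = Finset.univ :=
        Finset.filter_true_of_mem fun i _ => hlt.trans_le (Nat.le_add_right _ _)
      rw [this, Finset.card_univ, Fintype.card_fin]
      exact (Nat.mod_lt k hm).le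
    · have : (Finset.univ.filter fun i : Fin m => k / m < balancedVec (αk / m) S i) = S := by
        ext i
        by_cases hi : i ∈ S <;> simp [balancedVec, heq, hi]
      rw [this, hS]
      have h1 := Nat.div_add_mod k m
      have h2 := Nat.div_add_mod αk m
      rw [heq] at h1
      omega

lemma exists_of_mem_support_balancedRandom {m k : ℕ} {a : Fin m → ℕ}
    (ha : k % m ≤ (Finset.univ.filter fun i => k / m < a i).card) {r : Fin m → ℕ}
    (h : r ∈ (balancedRandom k a).support) :
    ∃ S : Finset (Fin m), S.card = k % m ∧ (∀ i ∈ S, k / m < a i) ∧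
      r = balancedVec (k / m) S := by
  rw [balancedRandom, PMF.mem_support_map_iff] at h
  obtain ⟨S, hS, rfl⟩ := h
  rw [mem_support_uniformOr (Finset.powersetCard_nonempty.2 ha), Finset.mem_powersetCard] at hS
  exact ⟨S, hS.2, fun i hi => by simpa using hS.1 hi, rfl⟩

/-- A comparison of costs between all outcomes of two random choices carries over to the expected
costs. -/
lemma tsum_le_tsum_of_support {β : Type*} (q q' : PMF β) (f : β → ℝ≥0∞)
    (h : ∀ r ∈ q.support, ∀ r' ∈ q'.support, f r ≤ f r') :
    ∑' r, q r * f r ≤ ∑' r, q' r * f r := by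
  have h1 : ∀ r' ∈ q'.support, ∑' r, q r * f r ≤ f r' := by
    intro r' hr'
    calc ∑' r, q r * f r ≤ ∑' r, q r * f r' := by
          refine ENNReal.tsum_le_tsum fun r => ?_
          by_cases hr : q r = 0
          · simp [hr]
          · exact mul_le_mul_right (h r ((PMF.mem_support_iff _ _).2 hr) r' hr') _
      _ = f r' := by rw [ENNReal.tsum_mul_right, q.tsum_coe, one_mul]
  calc ∑' r, q r * f r = ∑' r', q' r' * ∑' r, q r * f r := by
        rw [ENNReal.tsum_mul_right, q'.tsum_coe, one_mul]
    _ ≤ ∑' r', q' r' * f r' := by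
        refine ENNReal.tsum_le_tsum fun r' => ?_
        by_cases hr : q' r' = 0
        · simp [hr]
        · exact mul_le_mul_right (h1 r' ((PMF.mem_support_iff _ _).2 hr)) _

/-- For a given placement and given workloads, none of the policies has a larger expected cost than
the balanced random policy. -/
lemma tsum_routingLaw_le {m : ℕ} (hm : 0 < m) {c : ℝ} (hc : 0 ≤ c) (p : Policy) {k αk : ℕ}
    (hk : k ≤ αk) {w : Fin m → ℝ} {Φ : (Fin m → ℕ) → ℝ≥0∞} (hΦ : TransferMonotone c w Φ)
    {a : Fin m → ℕ} (ha : a ∈ (placementLaw m αk).support) :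
    ∑' r, routingLaw c p k a w r * Φ r ≤ ∑' r, balancedRandom k a r * Φ r := by
  classical
  obtain ⟨h1, h2, h3⟩ := placement_feasible hm hk ha
  cases p with
  | BR => exact le_rfl
  | WF =>
    refine tsum_le_tsum_of_support _ _ _ fun r hr r' hr' => ?_
    obtain ⟨S, hS, hSa, rfl⟩ := exists_of_mem_support_balancedRandom h3 hr'
    refine (greedyReach_waterFilling h1 hr).cost_le hc hΦ (fun i => Nat.zero_le _) (fun i => ?_) ?_
    · by_cases hi : i ∈ S
      · simpa [balancedVec, hi] using hSa i hi
      · simpa [balancedVec, hi] using h2 i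
    · rw [sum_balancedVec, hS, Nat.div_add_mod]
      simp
  | BS =>
    refine tsum_le_tsum_of_support _ _ _ fun r hr r' hr' => ?_
    obtain ⟨S, hS, hSa, rfl⟩ := exists_of_mem_support_balancedRandom h3 hr'
    refine (greedyReach_batchSamplingSteps h3 hr).cost_le hc hΦ
      (fun i => Nat.le_add_right _ _) (fun i => ?_) ?_
    · by_cases hi : i ∈ S
      · simp [balancedVec, batchCapacity, hi, hSa i hi]
      · simp [balancedVec, batchCapacity, hi]
    · rw [sum_balancedVec, hS]
      simp

lemma tsum_brLawGiven {m : ℕ} (α : ℕ → ℕ) (k : ℕ) (Φ : (Fin m → ℕ) → ℝ≥0∞) :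
    ∑' r, brLawGiven m α k r * Φ r
      = ∑' a, placementLaw m (α k) a * ∑' r, balancedRandom k a r * Φ r := by
  simp_rw [brLawGiven, PMF.bind_apply, ← ENNReal.tsum_mul_right, ← ENNReal.tsum_mul_left]
  rw [ENNReal.tsum_comm]
  simp_rw [mul_assoc]

lemma tsum_brLaw {m : ℕ} (α : ℕ → ℕ) (π : PMF ℕ) (Φ : (Fin m → ℕ) → ℝ≥0∞) :
    ∑' r, brLaw m α π r * Φ r = ∑' k, π k * ∑' r, brLawGiven m α k r * Φ r := by
  simp_rw [brLaw, PMF.bind_apply, ← ENNReal.tsum_mul_right, ← ENNReal.tsum_mul_left]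
  rw [ENNReal.tsum_comm]
  simp_rw [mul_assoc]

/-- Averaged over the placement, none of the policies has a larger expected cost than the balanced
random policy. -/
lemma tsum_placement_routing_le {m : ℕ} (hm : 0 < m) {c : ℝ} (hc : 0 ≤ c) (p : Policy) {k : ℕ}
    {α : ℕ → ℕ} (hk : k ≤ α k) {w : Fin m → ℝ} {Φ : (Fin m → ℕ) → ℝ≥0∞}
    (hΦ : TransferMonotone c w Φ) :
    ∑' a, placementLaw m (α k) a * ∑' r, routingLaw c p k a w r * Φ r
      ≤ ∑' r, brLawGiven m α k r * Φ r := by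
  rw [tsum_brLawGiven]
  refine ENNReal.tsum_le_tsum fun a => ?_
  by_cases ha : placementLaw m (α k) a = 0
  · simp [ha]
  · exact mul_le_mul_right (tsum_routingLaw_le hm hc p hk hΦ ((PMF.mem_support_iff _ _).2 ha)) _

/-- Routing vectors of the balanced random policy are balanced. -/
lemma balanced_of_mem_support {m : ℕ} (hm : 0 < m) {α : ℕ → ℕ} {k : ℕ} (hk : k ≤ α k)
    {r : Fin m → ℕ} (h : r ∈ (brLawGiven m α k).support) :
    ∑ i, r i = k ∧ ∀ i, r i = k / m ∨ r i = k / m + 1 := by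
  classical
  rw [brLawGiven, PMF.mem_support_bind_iff] at h
  obtain ⟨a, ha, hr⟩ := h
  obtain ⟨S, hS, -, rfl⟩ :=
    exists_of_mem_support_balancedRandom (placement_feasible hm hk ha).2.2 hr
  refine ⟨by rw [sum_balancedVec, hS, Nat.div_add_mod], fun i => ?_⟩
  by_cases hi : i ∈ S <;> simp [balancedVec, hi]

/-! ### Exchangeability of the balanced random policy -/

lemma map_equiv_apply {β γ : Type*} (p : PMF β) (e : β ≃ γ) (x : γ) :
    p.map e x = p (e.symm x) := by
  classical
  rw [PMF.map_apply, tsum_eq_single (e.symm x)]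
  · simp
  · intro b hb
    rw [if_neg]
    rintro rfl
    simp at hb

lemma uniformOr_map {β γ : Type*} (S : Finset β) (d : β) (e : β ≃ γ) :
    (uniformOr S d).map e = uniformOr (S.map e.toEmbedding) (e d) := by
  classical
  unfold uniformOr
  by_cases hS : S.Nonempty
  · rw [dif_pos hS, dif_pos (hS.map)]
    ext x
    rw [map_equiv_apply, PMF.uniformOfFinset_apply, PMF.uniformOfFinset_apply, Finset.card_map]
    simp
  · rw [dif_neg hS, dif_neg (by simpa using hS), PMF.pure_map]

lemma balancedVec_comp {m : ℕ} (q : ℕ) (S : Finset (Fin m)) (σ : Equiv.Perm (Fin m)) :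
    balancedVec q S ∘ σ = balancedVec q (S.map σ.symm.toEmbedding) := by
  classical
  funext i
  simp [balancedVec]

lemma map_balanced_comp {m : ℕ} (q n : ℕ) (U : Finset (Fin m)) (σ : Equiv.Perm (Fin m)) :
    ((uniformOr (Finset.powersetCard n U) ∅).map (balancedVec q)).map (fun r => r ∘ σ)
      = (uniformOr (Finset.powersetCard n (U.map σ.symm.toEmbedding)) ∅).map (balancedVec q) := by
  have h : (fun r : Fin m → ℕ => r ∘ σ) ∘ balancedVec q
      = balancedVec q ∘ (Equiv.finsetCongr σ.symm) :=
    funext fun S => balancedVec_comp q S σ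
  rw [PMF.map_comp, h, ← PMF.map_comp, uniformOr_map]
  congr 2
  rw [Finset.powersetCard_map]
  rfl

lemma placementLaw_comp {m : ℕ} (αk : ℕ) (σ : Equiv.Perm (Fin m)) :
    (placementLaw m αk).map (fun r => r ∘ σ) = placementLaw m αk := by
  rw [placementLaw, map_balanced_comp, Finset.map_univ_equiv]

lemma balancedRandom_comp {m : ℕ} (k : ℕ) (a : Fin m → ℕ) (σ : Equiv.Perm (Fin m)) :
    (balancedRandom k a).map (fun r => r ∘ σ) = balancedRandom k (a ∘ σ) := by
  rw [balancedRandom, balancedRandom, map_balanced_comp]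
  congr 3
  ext i
  simp

lemma brLawGiven_comp {m : ℕ} (α : ℕ → ℕ) (k : ℕ) (σ : Equiv.Perm (Fin m)) :
    (brLawGiven m α k).map (fun r => r ∘ σ) = brLawGiven m α k := by
  rw [brLawGiven, PMF.map_bind]
  simp_rw [balancedRandom_comp]
  conv_rhs => rw [← placementLaw_comp (α k) σ, PMF.bind_map]
  rfl

lemma tsum_brLawGiven_comp {m : ℕ} (α : ℕ → ℕ) (k : ℕ) (σ : Equiv.Perm (Fin m))
    (Φ : (Fin m → ℕ) → ℝ≥0∞) :
    ∑' r, brLawGiven m α k r * Φ (r ∘ σ) = ∑' r, brLawGiven m α k r * Φ r := by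
  let e : (Fin m → ℕ) ≃ (Fin m → ℕ) := σ.symm.arrowCongr (Equiv.refl ℕ)
  have he : ∀ r, e r = r ∘ σ := fun r => rfl
  have h : ∀ r, brLawGiven m α k (e r) = brLawGiven m α k r := by
    intro r
    conv_lhs => rw [← brLawGiven_comp α k σ]
    have := map_equiv_apply (brLawGiven m α k) e (e r)
    rwa [e.symm_apply_apply] at this
  rw [← e.tsum_eq fun r => brLawGiven m α k r * Φ r]
  exact tsum_congr fun r => by rw [h, he]

/-! ### Symmetric increasing convex functions of the workload vector -/

/-- Measurable, increasing, symmetric and convex functions on `ℝ^m` with values in `[0, ∞]`. -/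
structure SymmIncConvex {m : ℕ} (φ : (Fin m → ℝ) → ℝ≥0∞) : Prop where
  measurable : Measurable φ
  monotone : Monotone φ
  symm : ∀ (σ : Equiv.Perm (Fin m)) (x : Fin m → ℝ), φ (x ∘ σ) = φ x
  convex : ∀ (x y : Fin m → ℝ) (a b : ℝ), 0 ≤ a → 0 ≤ b → a + b = 1 →
    φ (a • x + b • y) ≤ ENNReal.ofReal a * φ x + ENNReal.ofReal b * φ y

/-- Moving the amount `c` from a larger to a smaller coordinate makes the vector a convex
combination of the original one and its transposition, so that symmetric convex functions
decrease. -/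
lemma SymmIncConvex.transferMonotone {m : ℕ} {χ : (Fin m → ℝ) → ℝ≥0∞} (hχ : SymmIncConvex χ)
    {c : ℝ} (hc : 0 < c) (w : Fin m → ℝ) :
    TransferMonotone c w fun r => χ fun i => w i + c * (r i : ℝ) := by
  intro s i j hij
  rcases eq_or_ne i j with rfl | hne
  · exact le_rfl
  set x : Fin m → ℝ := fun k => w k + c * ((s + Pi.single i 1 : Fin m → ℕ) k : ℝ) with hx
  set y : Fin m → ℝ := fun k => w k + c * ((s + Pi.single j 1 : Fin m → ℕ) k : ℝ) with hy
  set d : ℝ := (w i + c * (s i : ℝ)) - (w j + c * (s j : ℝ)) with hd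
  have hd0 : 0 ≤ d := sub_nonneg.2 hij
  have hdc : 0 < d + c := by linarith
  have hxi : x i = w i + c * (s i : ℝ) + c := by simp [hx]; ring
  have hxj : x j = w j + c * (s j : ℝ) := by simp [hx, hne.symm]
  -- the weights are determined by the `i`-th and the `j`-th coordinate
  have hcomb : y = (d / (d + c)) • x + (c / (d + c)) • (x ∘ Equiv.swap i j) := by
    funext k
    simp only [Pi.add_apply, Pi.smul_apply, smul_eq_mul, Function.comp_apply]
    by_cases hki : k = i
    · subst hki
      have : y k = w k + c * (s k : ℝ) := by simp [hy, hne]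
      rw [Equiv.swap_apply_left, this, hxi, hxj]
      field_simp
      rw [hd]
      ring
    by_cases hkj : k = j
    · subst hkj
      have : y k = w k + c * (s k : ℝ) + c := by simp [hy]; ring
      rw [Equiv.swap_apply_right, this, hxi, hxj]
      field_simp
      rw [hd]
      ring
    · have : y k = x k := by simp [hx, hy, hki, hkj]
      rw [Equiv.swap_apply_of_ne_of_ne hki hkj, this]
      field_simp
  change χ y ≤ χ x
  rw [hcomb]
  refine (hχ.convex _ _ _ _ (by positivity) (by positivity) (by field_simp)).trans ?_
  rw [hχ.symm, ← add_mul, ← ENNReal.ofReal_add (by positivity) (by positivity),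
    show d / (d + c) + c / (d + c) = 1 by field_simp]
  simp

/-- Expected value of `φ` after the servers have worked for a time of law `E`, starting from the
workload vector `x`. -/
def idleOp {m : ℕ} (mu : ℝ) (E : Measure ℝ) (φ : (Fin m → ℝ) → ℝ≥0∞) (x : Fin m → ℝ) : ℝ≥0∞ :=
  ∫⁻ t, φ (fun i => max (x i - mu * t) 0) ∂E

lemma SymmIncConvex.idleOp {m : ℕ} {φ : (Fin m → ℝ) → ℝ≥0∞} (hφ : SymmIncConvex φ) (mu : ℝ)
    (E : Measure ℝ) [IsProbabilityMeasure E] : SymmIncConvex (idleOp mu E φ) := by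
  have hjoint : Measurable fun z : (Fin m → ℝ) × ℝ => φ fun i => max (z.1 i - mu * z.2) 0 :=
    hφ.measurable.comp (measurable_pi_iff.2 fun i =>
      Measurable.max (by fun_prop) measurable_const)
  have hfix : ∀ x : Fin m → ℝ, Measurable fun t => φ fun i => max (x i - mu * t) 0 := fun x =>
    hjoint.comp measurable_prodMk_left
  refine ⟨hjoint.lintegral_prod_right', fun x y hxy => ?_, fun σ x => ?_,
    fun x y a b ha hb hab => ?_⟩
  · exact lintegral_mono fun t => hφ.monotone fun i =>
      max_le_max (by have := hxy i; linarith) le_rfl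
  · exact lintegral_congr fun t => hφ.symm σ fun i => max (x i - mu * t) 0
  · unfold MDSDelivery.idleOp
    rw [← lintegral_const_mul _ (hfix x), ← lintegral_const_mul _ (hfix y),
      ← lintegral_add_left ((hfix x).const_mul _)]
    refine lintegral_mono fun t => le_trans (hφ.monotone fun i => ?_)
      (hφ.convex (fun i => max (x i - mu * t) 0) (fun i => max (y i - mu * t) 0) a b ha hb hab)
    simp only [Pi.add_apply, Pi.smul_apply, smul_eq_mul]
    have h1 := mul_le_mul_of_nonneg_left (le_max_left (x i - mu * t) 0) ha
    have h2 := mul_le_mul_of_nonneg_left (le_max_left (y i - mu * t) 0) hb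
    have h3 := mul_nonneg ha (le_max_right (x i - mu * t) 0)
    have h4 := mul_nonneg hb (le_max_right (y i - mu * t) 0)
    have h5 : mu * t = a * (mu * t) + b * (mu * t) := by rw [← add_mul, hab, one_mul]
    exact max_le (by linarith) (by linarith)

/-- Averaging over an exchangeable routing vector preserves the class. -/
lemma symmIncConvex_tsum {m : ℕ} (q : PMF (Fin m → ℕ))
    (hq : ∀ (σ : Equiv.Perm (Fin m)) (Φ : (Fin m → ℕ) → ℝ≥0∞),
      ∑' r, q r * Φ (r ∘ σ) = ∑' r, q r * Φ r)
    {F : (Fin m → ℕ) → (Fin m → ℝ) → ℝ≥0∞} (hmeas : ∀ r, Measurable (F r))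
    (hmono : ∀ r, Monotone (F r))
    (hsymm : ∀ (σ : Equiv.Perm (Fin m)) r x, F (r ∘ σ) (x ∘ σ) = F r x)
    (hconv : ∀ r (x y : Fin m → ℝ) (a b : ℝ), 0 ≤ a → 0 ≤ b → a + b = 1 →
      F r (a • x + b • y) ≤ ENNReal.ofReal a * F r x + ENNReal.ofReal b * F r y) :
    SymmIncConvex fun w => ∑' r, q r * F r w := by
  refine ⟨Measurable.tsum fun r => (hmeas r).const_mul _, fun x y hxy =>
    ENNReal.tsum_le_tsum fun r => mul_le_mul_right (hmono r hxy) _, fun σ x => ?_,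
    fun x y a b ha hb hab => ?_⟩
  · rw [← hq σ]
    simp_rw [hsymm]
  · rw [← ENNReal.tsum_mul_left, ← ENNReal.tsum_mul_left, ← ENNReal.tsum_add]
    refine ENNReal.tsum_le_tsum fun r => ?_
    refine (mul_le_mul_right (hconv r x y a b ha hb hab) _).trans (le_of_eq ?_)
    ring

/-- The transition operator of the workload chain with routing vectors of law `q`. -/
def chainOp {m : ℕ} (c mu : ℝ) (q : PMF (Fin m → ℕ)) (E : Measure ℝ)
    (φ : (Fin m → ℝ) → ℝ≥0∞) (w : Fin m → ℝ) : ℝ≥0∞ :=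
  ∑' r, q r * idleOp mu E φ fun i => w i + c * (r i : ℝ)

lemma SymmIncConvex.comp_add {m : ℕ} {χ : (Fin m → ℝ) → ℝ≥0∞} (hχ : SymmIncConvex χ)
    (z x y : Fin m → ℝ) {a b : ℝ} (ha : 0 ≤ a) (hb : 0 ≤ b) (hab : a + b = 1) :
    χ (fun i => (a • x + b • y) i + z i)
      ≤ ENNReal.ofReal a * χ (fun i => x i + z i) + ENNReal.ofReal b * χ fun i => y i + z i := by
  refine le_trans (le_of_eq ?_) (hχ.convex _ _ a b ha hb hab)
  congr 1
  funext i
  simp only [Pi.add_apply, Pi.smul_apply, smul_eq_mul]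
  have : z i = a * z i + b * z i := by rw [← add_mul, hab, one_mul]
  linarith

lemma SymmIncConvex.chainOp {m : ℕ} {φ : (Fin m → ℝ) → ℝ≥0∞} (hφ : SymmIncConvex φ) (c mu : ℝ)
    {q : PMF (Fin m → ℕ)} (hq : ∀ (σ : Equiv.Perm (Fin m)) (Φ : (Fin m → ℕ) → ℝ≥0∞),
      ∑' r, q r * Φ (r ∘ σ) = ∑' r, q r * Φ r)
    (E : Measure ℝ) [IsProbabilityMeasure E] : SymmIncConvex (chainOp c mu q E φ) := by
  have hχ := hφ.idleOp mu E
  refine symmIncConvex_tsum q hq (fun r => hχ.measurable.comp (by fun_prop))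
    (fun r x y hxy => hχ.monotone fun i => add_le_add_left (hxy i) _) (fun σ r x => ?_)
    (fun r x y a b ha hb hab => hχ.comp_add _ x y ha hb hab)
  exact hχ.symm σ fun i => x i + c * (r i : ℝ)

lemma lintegral_chainStep {m : ℕ} (c mu : ℝ) (q : PMF (Fin m → ℕ)) (E : Measure ℝ)
    [IsProbabilityMeasure E] (M : Measure (Fin m → ℝ)) [IsProbabilityMeasure M]
    {φ : (Fin m → ℝ) → ℝ≥0∞} (hφ : Measurable φ) :
    ∫⁻ x, φ x ∂chainStep c mu q E M = ∫⁻ w, chainOp c mu q E φ w ∂M := by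
  have hF : Measurable fun z : (Fin m → ℝ) × (Fin m → ℕ) × ℝ =>
    φ (nextWorkload c mu z.1 z.2.1 z.2.2) := hφ.comp (measurable_nextWorkload c mu)
  rw [chainStep, lintegral_map hφ (measurable_nextWorkload c mu), lintegral_prod _ hF.aemeasurable]
  refine lintegral_congr fun w => ?_
  have hFw : Measurable fun y : (Fin m → ℕ) × ℝ => φ (nextWorkload c mu w y.1 y.2) :=
    hF.comp measurable_prodMk_left
  exact (lintegral_prod _ hFw.aemeasurable).trans (lintegral_toMeasure q _)

/-! ### The delay as a function of workloads and requests -/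

lemma le_delay {m : ℕ} (c : ℝ) (w : Fin m → ℝ) {r : Fin m → ℕ} {i : Fin m} (hi : 0 < r i) :
    w i + c * (r i : ℝ) ≤ delay c w r :=
  le_ciSup (f := fun i : {i : Fin m // 0 < r i} => w i + c * (r i : ℝ))
    (Set.finite_range _).bddAbove ⟨i, hi⟩

lemma delay_le {m : ℕ} {c : ℝ} {w : Fin m → ℝ} {r : Fin m → ℕ} (hr : ∃ i, 0 < r i) {x : ℝ}
    (h : ∀ i, 0 < r i → w i + c * (r i : ℝ) ≤ x) : delay c w r ≤ x := by
  have : Nonempty {i : Fin m // 0 < r i} := let ⟨i, hi⟩ := hr; ⟨⟨i, hi⟩⟩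
  exact ciSup_le fun i => h i i.2

lemma delay_nonneg {m : ℕ} {c : ℝ} (hc : 0 ≤ c) {w : Fin m → ℝ} (hw : 0 ≤ w) (r : Fin m → ℕ) :
    0 ≤ delay c w r :=
  Real.iSup_nonneg fun i => add_nonneg (hw i) (by positivity)

lemma delay_mono {m : ℕ} (c : ℝ) (r : Fin m → ℕ) : Monotone fun w => delay c w r := by
  intro x y hxy
  by_cases hr : ∃ i, 0 < r i
  · exact delay_le hr fun i hi => (add_le_add_left (hxy i) _).trans (le_delay c y hi)
  · simp [delay_of_forall_eq_zero c _ hr]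

lemma delay_convex {m : ℕ} (c : ℝ) (r : Fin m → ℕ) (x y : Fin m → ℝ) {a b : ℝ} (ha : 0 ≤ a)
    (hb : 0 ≤ b) (hab : a + b = 1) :
    delay c (a • x + b • y) r ≤ a * delay c x r + b * delay c y r := by
  by_cases hr : ∃ i, 0 < r i
  · refine delay_le hr fun i hi => ?_
    have h1 := mul_le_mul_of_nonneg_left (le_delay c x hi) ha
    have h2 := mul_le_mul_of_nonneg_left (le_delay c y hi) hb
    have h3 : c * (r i : ℝ) = a * (c * r i) + b * (c * r i) := by rw [← add_mul, hab, one_mul]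
    simp only [Pi.add_apply, Pi.smul_apply, smul_eq_mul]
    linarith
  · simp [delay_of_forall_eq_zero c _ hr]

lemma delay_comp {m : ℕ} (c : ℝ) (w : Fin m → ℝ) (r : Fin m → ℕ) (σ : Equiv.Perm (Fin m)) :
    delay c (w ∘ σ) (r ∘ σ) = delay c w r :=
  Equiv.iSup_congr (g := fun j : {i : Fin m // 0 < r i} => w j + c * (r j : ℝ))
    (σ.subtypeEquiv fun _ => Iff.rfl) fun _ => rfl

/-- The maximum of the updated workloads over the servers in use does not increase under
transfers, although it is not a symmetric function of the updated workloads. -/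
lemma delay_transfer {m : ℕ} {c : ℝ} (hc : 0 ≤ c) (w : Fin m → ℝ) (s : Fin m → ℕ) {i j : Fin m}
    (hij : w j + c * (s j : ℝ) ≤ w i + c * (s i : ℝ)) :
    delay c w (s + Pi.single j 1) ≤ delay c w (s + Pi.single i 1) := by
  have hi : w i + c * (s i : ℝ) + c ≤ delay c w (s + Pi.single i 1) := by
    refine le_trans (le_of_eq ?_) (le_delay c w (i := i) (by simp))
    simp; ring
  refine delay_le ⟨j, by simp⟩ fun k hk => ?_
  by_cases hkj : k = j
  · subst hkj
    simp only [Pi.add_apply, Pi.single_eq_same, Nat.cast_add, Nat.cast_one]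
    linarith
  · have hsk : (s + Pi.single j 1 : Fin m → ℕ) k = s k := by simp [hkj]
    have hle : s k ≤ (s + Pi.single i 1 : Fin m → ℕ) k := by simp
    rw [hsk] at hk ⊢
    refine le_trans ?_ (le_delay c w (hk.trans_le hle))
    have := mul_le_mul_of_nonneg_left (Nat.cast_le (α := ℝ).2 hle) hc
    linarith

lemma transferMonotone_delay {m : ℕ} {c : ℝ} (hc : 0 ≤ c) (w : Fin m → ℝ) {g : ℝ → ℝ}
    (hg : Monotone g) : TransferMonotone c w fun r => ENNReal.ofReal (g (delay c w r)) :=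
  fun s _ _ hij => ENNReal.ofReal_le_ofReal (hg (delay_transfer hc w s hij))

/-- The expected increasing convex cost of the delay under the balanced random policy, as a function
of the workload vector, is symmetric, increasing and convex. -/
lemma symmIncConvex_delay {m : ℕ} (c : ℝ) (α : ℕ → ℕ) (k : ℕ) {g : ℝ → ℝ} (hg : Monotone g)
    (hconv : ConvexOn ℝ Set.univ g) :
    SymmIncConvex fun w : Fin m → ℝ =>
      ∑' r, brLawGiven m α k r * ENNReal.ofReal (g (delay c w r)) := by
  refine symmIncConvex_tsum _ (tsum_brLawGiven_comp α k)
    (fun r => (hg.measurable.comp (measurable_delay c r)).ennreal_ofReal)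
    (fun r x y hxy => ENNReal.ofReal_le_ofReal (hg (delay_mono c r hxy)))
    (fun σ r x => by rw [delay_comp]) fun r x y a b ha hb hab => ?_
  rw [← ENNReal.ofReal_mul ha, ← ENNReal.ofReal_mul hb]
  refine le_trans (ENNReal.ofReal_le_ofReal ?_) ENNReal.ofReal_add_le
  exact (hg (delay_convex c r x y ha hb hab)).trans
    (hconv.2 (Set.mem_univ _) (Set.mem_univ _) ha hb hab)

/-! ### Comparison of the system with the balanced random chain -/

/-- Integration against an event with known conditional probability. -/
lemma setLIntegral_eq_of_condExp {Ω : Type*} {𝒢 mΩ : MeasurableSpace Ω} (h𝒢 : 𝒢 ≤ mΩ)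
    {P : Measure Ω} [IsProbabilityMeasure P] {A : Set Ω} (hA : MeasurableSet A) {f : Ω → ℝ≥0∞}
    (hf1 : ∀ ω, f ω ≤ 1)
    (hf : P[Set.indicator A (fun _ => (1 : ℝ)) | 𝒢] =ᵐ[P] fun ω => (f ω).toReal)
    {Z : Ω → ℝ≥0∞} (hZ : Measurable[𝒢] Z) :
    AEMeasurable f P ∧ ∫⁻ ω in A, Z ω ∂P = ∫⁻ ω, f ω * Z ω ∂P := by
  have hfin : ∀ ω, f ω ≠ ∞ := fun ω => ((hf1 ω).trans_lt ENNReal.one_lt_top).ne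
  have hreal : AEMeasurable (fun ω => (f ω).toReal) P :=
    (integrable_condExp.1.congr hf).aemeasurable
  have hfm : AEMeasurable f P := by
    have := hreal.ennreal_ofReal
    simpa only [ENNReal.ofReal_toReal (hfin _)] using this
  refine ⟨hfm, ?_⟩
  -- conditional probability, rephrased as an equality of measures on `𝒢`
  have htrim : (P.restrict A).trim h𝒢 = (P.withDensity f).trim h𝒢 := by
    refine @Measure.ext _ 𝒢 _ _ fun B hB => ?_
    have hB' := h𝒢 B hB
    rw [trim_measurableSet_eq h𝒢 hB, trim_measurableSet_eq h𝒢 hB, Measure.restrict_apply hB',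
      withDensity_apply _ hB']
    have h1 := setIntegral_condExp h𝒢 (μ := P) (f := Set.indicator A fun _ => (1 : ℝ))
      ((integrable_const 1).indicator hA) hB
    rw [setIntegral_congr_ae hB' (hf.mono fun ω hω _ => hω),
      integral_toReal hfm.restrict (Eventually.of_forall fun ω => (hfin ω).lt_top),
      integral_indicator hA, Measure.restrict_restrict hA] at h1
    simp only [integral_const, smul_eq_mul, mul_one, Measure.real,
      Measure.restrict_apply_univ] at h1
    have h2 : ∫⁻ ω in B, f ω ∂P ≠ ∞ :=
      ((lintegral_mono hf1).trans_lt (by simp)).ne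
    rw [Set.inter_comm]
    exact ((ENNReal.toReal_eq_toReal_iff' h2 (measure_ne_top _ _)).1 h1).symm
  rw [← lintegral_trim h𝒢 hZ, htrim, lintegral_trim h𝒢 hZ,
    lintegral_withDensity_eq_lintegral_mul₀ hfm (hZ.mono h𝒢 le_rfl).aemeasurable]
  rfl

lemma lintegral_eq_tsum_fiber {Ω β : Type*} [MeasurableSpace Ω] (P : Measure Ω) [Countable β]
    [MeasurableSpace β] [MeasurableSingletonClass β] {Y : Ω → β} (hY : Measurable Y)
    (f : Ω → ℝ≥0∞) : ∫⁻ ω, f ω ∂P = ∑' y, ∫⁻ ω in Y ⁻¹' {y}, f ω ∂P := by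
  rw [← lintegral_iUnion (fun y => hY (measurableSet_singleton y)), ← Set.preimage_iUnion,
    Set.iUnion_of_singleton, Set.preimage_univ, Measure.restrict_univ]
  intro y z hyz
  exact Disjoint.preimage _ (Set.disjoint_singleton.2 hyz)

/-- Measurability of the updated workloads, with respect to any σ-algebra on `Ω`. -/
lemma measurable_updated {Ω : Type*} {𝒢 : MeasurableSpace Ω} {m : ℕ} (c : ℝ) {W : Ω → Fin m → ℝ}
    {s : Ω → Fin m → ℕ} (hW : Measurable W) (hs : Measurable s) :
    Measurable fun ω i => W ω i + c * (s ω i : ℝ) :=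
  measurable_pi_iff.2 fun i => ((measurable_pi_apply i).comp hW).add
    (((measurable_coord_cast i).comp hs).const_mul c)

lemma workload_nonneg {Ω : Type*} {m : ℕ} (c mu : ℝ) (s : ℕ → Ω → Fin m → ℕ) (τ : ℕ → Ω → ℝ)
    (n : ℕ) (ω : Ω) : 0 ≤ workload c mu s τ n ω := by
  cases n with
  | zero => exact le_rfl
  | succ n => exact fun i => le_max_right _ _

section System

variable {Ω : Type*} [mΩ : MeasurableSpace Ω] {P : Measure Ω} {ℱ : Filtration ℕ mΩ} {m : ℕ}
  {c lam mu : ℝ} {α : ℕ → ℕ} {π : PMF ℕ} {p : Policy} {κ : ℕ → Ω → ℕ}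
  {a s : ℕ → Ω → Fin m → ℕ} {τ : ℕ → Ω → ℝ}

lemma IsSystem.measurable_workload (h : IsSystem P ℱ m c lam mu α π p κ a s τ) (n : ℕ) :
    Measurable[ℱ n] (workload c mu s τ n) := by
  induction n with
  | zero => exact measurable_const
  | succ n ih =>
    have h1 : Measurable[ℱ (n + 1)] (workload c mu s τ n) := ih.mono (ℱ.mono n.le_succ) le_rfl
    exact (measurable_nextWorkload c mu).comp
      (h1.prodMk ((h.measurable_routing n).prodMk (h.measurable_interarrival n)))

lemma IsSystem.measurable_triple (h : IsSystem P ℱ m c lam mu α π p κ a s τ) (n : ℕ) :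
    Measurable fun ω => (κ n ω, a n ω, s n ω) :=
  (((h.measurable_size n).mono (ℱ.le _) le_rfl).prodMk
    (((h.measurable_placement n).mono (ℱ.le _) le_rfl).prodMk
      ((h.measurable_routing n).mono (ℱ.le _) le_rfl)))

/-- Expected cost of the routing decision, in terms of the conditional law given the past. -/
lemma IsSystem.lintegral_routing [IsProbabilityMeasure P]
    (h : IsSystem P ℱ m c lam mu α π p κ a s τ) (n : ℕ)
    {Ψ : ℕ → (Fin m → ℕ) → (Fin m → ℝ) → ℝ≥0∞} (hΨ : ∀ k r, Measurable (Ψ k r)) :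
    ∫⁻ ω, Ψ (κ n ω) (s n ω) (workload c mu s τ n ω) ∂P
      = ∫⁻ ω, ∑' k, π k * ∑' b, placementLaw m (α k) b *
          ∑' r, routingLaw c p k b (workload c mu s τ n ω) r *
            Ψ k r (workload c mu s τ n ω) ∂P := by
  have hY := h.measurable_triple n
  have hW := h.measurable_workload n
  let f : ℕ × (Fin m → ℕ) × (Fin m → ℕ) → Ω → ℝ≥0∞ := fun y ω =>
    π y.1 * placementLaw m (α y.1) y.2.1 * routingLaw c p y.1 y.2.1 (workload c mu s τ n ω) y.2.2
  have hstep : ∀ y : ℕ × (Fin m → ℕ) × (Fin m → ℕ), AEMeasurable (f y) P ∧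
      ∫⁻ ω in (fun ω => (κ n ω, a n ω, s n ω)) ⁻¹' {y}, Ψ y.1 y.2.2 (workload c mu s τ n ω) ∂P
        = ∫⁻ ω, f y ω * Ψ y.1 y.2.2 (workload c mu s τ n ω) ∂P := by
    rintro ⟨k, b, r⟩
    refine setLIntegral_eq_of_condExp (ℱ.le n) (hY (measurableSet_singleton _)) (fun ω => ?_) ?_
      ((hΨ k r).comp hW)
    · exact mul_le_one' (mul_le_one' (PMF.coe_le_one _ _) (PMF.coe_le_one _ _)) (PMF.coe_le_one _ _)
    · have hset : (fun ω => (κ n ω, a n ω, s n ω)) ⁻¹' {(k, b, r)}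
          = {ω | κ n ω = k ∧ a n ω = b ∧ s n ω = r} := by ext; simp
      rw [hset]
      exact h.condLaw n k b r
  rw [lintegral_eq_tsum_fiber P hY]
  have hfib : ∀ y : ℕ × (Fin m → ℕ) × (Fin m → ℕ),
      ∫⁻ ω in (fun ω => (κ n ω, a n ω, s n ω)) ⁻¹' {y},
        Ψ (κ n ω) (s n ω) (workload c mu s τ n ω) ∂P
      = ∫⁻ ω, f y ω * Ψ y.1 y.2.2 (workload c mu s τ n ω) ∂P := by
    intro y
    rw [← (hstep y).2]
    refine setLIntegral_congr_fun (hY (measurableSet_singleton _)) fun ω hω => ?_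
    simp only [Set.mem_preimage, Set.mem_singleton_iff] at hω
    simp [← hω]
  simp_rw [hfib]
  have hm : ∀ y, AEMeasurable (fun ω => f y ω * Ψ y.1 y.2.2 (workload c mu s τ n ω)) P := fun y =>
    (hstep y).1.mul ((hΨ _ _).comp (hW.mono (ℱ.le n) le_rfl)).aemeasurable
  rw [← lintegral_tsum hm]
  refine lintegral_congr fun ω => ?_
  rw [ENNReal.tsum_prod']
  refine tsum_congr fun k => ?_
  rw [ENNReal.tsum_prod', ← ENNReal.tsum_mul_left]
  refine tsum_congr fun b => ?_
  rw [← ENNReal.tsum_mul_left, ← ENNReal.tsum_mul_left]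
  exact tsum_congr fun r => by simp only [f, mul_assoc]

/-- Routing decisions under any of the policies are at most as expensive as under the balanced
random policy, for every cost that does not increase under transfers. -/
lemma IsSystem.lintegral_routing_le [IsProbabilityMeasure P]
    (h : IsSystem P ℱ m c lam mu α π p κ a s τ) (hm : 0 < m) (hc : 0 ≤ c) (hα : ∀ k, k ≤ α k)
    (n : ℕ) {Ψ : ℕ → (Fin m → ℕ) → (Fin m → ℝ) → ℝ≥0∞} (hΨ : ∀ k r, Measurable (Ψ k r))
    (htr : ∀ k w, TransferMonotone c w fun r => Ψ k r w) :
    ∫⁻ ω, Ψ (κ n ω) (s n ω) (workload c mu s τ n ω) ∂P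
      ≤ ∫⁻ ω, ∑' k, π k * ∑' r, brLawGiven m α k r * Ψ k r (workload c mu s τ n ω) ∂P := by
  rw [h.lintegral_routing n hΨ]
  exact lintegral_mono fun ω => ENNReal.tsum_le_tsum fun k =>
    mul_le_mul_right (tsum_placement_routing_le hm hc p (hα k) (htr k _)) _

/-- The interarrival time after a request is independent of everything that determines the
workloads right after this request. -/
lemma IsSystem.lintegral_workload_succ [IsProbabilityMeasure P]
    (h : IsSystem P ℱ m c lam mu α π p κ a s τ) (hlam : 0 < lam) (n : ℕ)
    {φ : (Fin m → ℝ) → ℝ≥0∞} (hφ : Measurable φ) :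
    ∫⁻ ω, φ (workload c mu s τ (n + 1) ω) ∂P
      = ∫⁻ ω, idleOp mu (expMeasure lam) φ
          (fun i => workload c mu s τ n ω i + c * (s n ω i : ℝ)) ∂P := by
  have := isProbabilityMeasure_expMeasure hlam
  let X : Ω → Fin m → ℝ := fun ω i => workload c mu s τ n ω i + c * (s n ω i : ℝ)
  have hXG : Measurable[ℱ n ⊔ MeasurableSpace.comap (fun ω => (κ n ω, a n ω, s n ω)) inferInstance]
      X := by
    have hle : MeasurableSpace.comap (fun ω => (κ n ω, a n ω, s n ω)) inferInstance
      ≤ ℱ n ⊔ MeasurableSpace.comap (fun ω => (κ n ω, a n ω, s n ω)) inferInstance := le_sup_right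
    exact measurable_updated c ((h.measurable_workload n).mono le_sup_left le_rfl)
      (measurable_snd.comp (measurable_snd.comp ((comap_measurable _).mono hle le_rfl)))
  have hXm : Measurable X :=
    hXG.mono (sup_le (ℱ.le n) (h.measurable_triple n).comap_le) le_rfl
  have hτm : Measurable (τ n) := (h.measurable_interarrival n).mono (ℱ.le _) le_rfl
  have hind : IndepFun X (τ n) P := by
    rw [IndepFun_iff_Indep]
    exact (indep_of_indep_of_le_right (h.indep_interarrival n) hXG.comap_le).symm
  -- the joint law of the updated workloads and the interarrival time is a product
  have hmap := (indepFun_iff_map_prod_eq_prod_map_map hXm.aemeasurable hτm.aemeasurable).1 hind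
  have hF : Measurable fun z : (Fin m → ℝ) × ℝ => φ fun i => max (z.1 i - mu * z.2) 0 :=
    hφ.comp (measurable_pi_iff.2 fun i => Measurable.max (by fun_prop) measurable_const)
  calc ∫⁻ ω, φ (workload c mu s τ (n + 1) ω) ∂P
      = ∫⁻ z, φ (fun i => max (z.1 i - mu * z.2) 0) ∂P.map (fun ω => (X ω, τ n ω)) := by
        rw [lintegral_map hF (hXm.prodMk hτm)]
        rfl
    _ = ∫⁻ x, idleOp mu (expMeasure lam) φ x ∂P.map X := by
        rw [hmap, h.law_interarrival n, lintegral_prod _ hF.aemeasurable]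
        rfl
    _ = _ := lintegral_map hF.lintegral_prod_right' hXm

lemma tsum_brLaw_comp (α : ℕ → ℕ) (π : PMF ℕ) (σ : Equiv.Perm (Fin m))
    (Φ : (Fin m → ℕ) → ℝ≥0∞) :
    ∑' r, brLaw m α π r * Φ (r ∘ σ) = ∑' r, brLaw m α π r * Φ r := by
  rw [tsum_brLaw α π fun r => Φ (r ∘ σ), tsum_brLaw]
  simp_rw [tsum_brLawGiven_comp]

/-- Symmetric increasing convex costs of the workload vector are at most as large as under the
balanced random policy. The induction runs backwards in time: the transition operator of the
balanced random chain preserves this class of costs and dominates the transition operators of the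
other policies on it. -/
lemma IsSystem.lintegral_workload_le [IsProbabilityMeasure P]
    (h : IsSystem P ℱ m c lam mu α π p κ a s τ) (hm : 0 < m) (hc : 0 < c) (hlam : 0 < lam)
    (hα : ∀ k, k ≤ α k) (n : ℕ) {φ : (Fin m → ℝ) → ℝ≥0∞} (hφ : SymmIncConvex φ) :
    ∫⁻ ω, φ (workload c mu s τ n ω) ∂P
      ≤ ∫⁻ w, φ w ∂(chainStep c mu (brLaw m α π) (expMeasure lam))^[n] (Measure.dirac 0) := by
  have := isProbabilityMeasure_expMeasure hlam
  induction n generalizing φ with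
  | zero =>
    simp only [workload, Function.iterate_zero, id_eq, lintegral_const, measure_univ, mul_one]
    rw [lintegral_dirac' _ hφ.measurable]
    rfl
  | succ n ih =>
    have hprob := isProbabilityMeasure_iterate_chainStep c mu (brLaw m α π) (expMeasure lam)
      (Measure.dirac (0 : Fin m → ℝ)) n
    have hχ := hφ.idleOp mu (expMeasure lam)
    rw [Function.iterate_succ_apply', lintegral_chainStep _ _ _ _ _ hφ.measurable,
      h.lintegral_workload_succ hlam n hφ.measurable]
    refine le_trans ?_ (ih (hφ.chainOp c mu (tsum_brLaw_comp α π) (expMeasure lam)))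
    refine (h.lintegral_routing_le hm hc.le hα n
      (Ψ := fun _ r w => idleOp mu (expMeasure lam) φ fun i => w i + c * (r i : ℝ))
      (fun _ r => hχ.measurable.comp (by fun_prop))
      fun _ w => hχ.transferMonotone hc w).trans (le_of_eq ?_)
    exact lintegral_congr fun ω => (tsum_brLaw α π _).symm

/-- The expected cost of the delay of the `n`-th request on the event that it is of size `k`. -/
lemma IsSystem.setLIntegral_delay_le [IsProbabilityMeasure P]
    (h : IsSystem P ℱ m c lam mu α π p κ a s τ) (hm : 0 < m) (hc : 0 < c) (hlam : 0 < lam)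
    (hα : ∀ k, k ≤ α k) (n k : ℕ) {g : ℝ → ℝ} (hg : Monotone g)
    (hconv : ConvexOn ℝ Set.univ g) :
    ∫⁻ ω in κ n ⁻¹' {k}, ENNReal.ofReal (g (delay c (workload c mu s τ n ω) (s n ω))) ∂P
      ≤ π k * ∑' r, brLawGiven m α k r * ∫⁻ w, ENNReal.ofReal (g (delay c w r))
          ∂(chainStep c mu (brLaw m α π) (expMeasure lam))^[n] (Measure.dirac 0) := by
  classical
  have hmeas : ∀ r : Fin m → ℕ, Measurable fun w => ENNReal.ofReal (g (delay c w r)) := fun r =>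
    (hg.measurable.comp (measurable_delay c r)).ennreal_ofReal
  have hκ : Measurable (κ n) := (h.measurable_size n).mono (ℱ.le _) le_rfl
  rw [← lintegral_indicator (hκ (measurableSet_singleton k))]
  have hrepr : ∀ ω, (κ n ⁻¹' {k}).indicator
      (fun ω => ENNReal.ofReal (g (delay c (workload c mu s τ n ω) (s n ω)))) ω
      = (fun k' r w => if k' = k then ENNReal.ofReal (g (delay c w r)) else 0)
          (κ n ω) (s n ω) (workload c mu s τ n ω) := fun ω => by
    simp [Set.indicator_apply]
  simp_rw [hrepr]
  refine (h.lintegral_routing_le hm hc.le hα n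
    (Ψ := fun k' r w => if k' = k then ENNReal.ofReal (g (delay c w r)) else 0)
    (fun k' r => ?_) fun k' w => ?_).trans ?_
  · by_cases hk : k' = k <;> simp [hk, hmeas r]
  · by_cases hk : k' = k
    · simpa [hk] using transferMonotone_delay hc.le w hg
    · intro _ _ _ _
      simp [hk]
  · have hsum : ∀ w, ∑' k', π k' * ∑' r, brLawGiven m α k' r *
        (if k' = k then ENNReal.ofReal (g (delay c w r)) else 0)
        = π k * ∑' r, brLawGiven m α k r * ENNReal.ofReal (g (delay c w r)) := by
      intro w
      rw [tsum_eq_single k fun k' hk => by simp [hk]]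
      simp
    have hS := symmIncConvex_delay (m := m) c α k hg hconv
    simp_rw [hsum]
    rw [lintegral_const_mul' _ _ (π.apply_ne_top k)]
    refine mul_le_mul_right ((h.lintegral_workload_le hm hc hlam hα n hS).trans (le_of_eq ?_)) _
    rw [lintegral_tsum fun r => ((hmeas r).const_mul _).aemeasurable]
    exact tsum_congr fun r => lintegral_const_mul _ (hmeas r)

lemma IsSystem.measure_size [IsProbabilityMeasure P]
    (h : IsSystem P ℱ m c lam mu α π p κ a s τ) (n k : ℕ) : P (κ n ⁻¹' {k}) = π k := by
  classical
  have hκ : Measurable (κ n) := (h.measurable_size n).mono (ℱ.le _) le_rfl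
  rw [← lintegral_indicator_one (hκ (measurableSet_singleton k))]
  have := h.lintegral_routing n (Ψ := fun k' _ _ => if k' = k then 1 else 0)
    fun _ _ => measurable_const
  have hrepr : ∀ ω, (κ n ⁻¹' {k}).indicator (1 : Ω → ℝ≥0∞) ω = if κ n ω = k then 1 else 0 :=
    fun ω => by simp [Set.indicator_apply]
  simp_rw [hrepr, this, ENNReal.tsum_mul_right, PMF.tsum_coe, one_mul,
    ENNReal.tsum_mul_right, PMF.tsum_coe, one_mul]
  simp

end System

/-! ### The service law of the cavity queue -/

/-- The probability that a given server receives `l` of `k` blocks under the balanced random policy: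
the weights of the balanced decomposition of `k / m` into neighbouring integers. -/
def tent (m k l : ℕ) : ℝ := max (1 - |(k : ℝ) / m - l|) 0

lemma tent_nonneg (m k l : ℕ) : 0 ≤ tent m k l := le_max_right _ _

lemma tent_le_one (m k l : ℕ) : tent m k l ≤ 1 :=
  max_le (by linarith [abs_nonneg ((k : ℝ) / m - l)]) zero_le_one

lemma tent_of_le_of_le {m k l : ℕ} (hm : 0 < m) (h1 : l * m ≤ k) (h2 : k ≤ (l + 1) * m) :
    tent m k l = 1 - (k : ℝ) / m + l := by
  have hm' : (0 : ℝ) < m := Nat.cast_pos.2 hm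
  have h3 : (l : ℝ) ≤ k / m := by rw [le_div_iff₀ hm']; exact_mod_cast h1
  have h4 : (k : ℝ) / m ≤ l + 1 := by rw [div_le_iff₀ hm']; exact_mod_cast h2
  rw [tent, abs_of_nonneg (by linarith), max_eq_left (by linarith)]
  ring

lemma tent_succ_of_le_of_le {m k l : ℕ} (hm : 0 < m) (h1 : l * m ≤ k) (h2 : k ≤ (l + 1) * m) :
    tent m k (l + 1) = (k : ℝ) / m - l := by
  have hm' : (0 : ℝ) < m := Nat.cast_pos.2 hm
  have h3 : (l : ℝ) ≤ k / m := by rw [le_div_iff₀ hm']; exact_mod_cast h1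
  have h4 : (k : ℝ) / m ≤ l + 1 := by rw [div_le_iff₀ hm']; exact_mod_cast h2
  rw [tent, abs_of_nonpos (by push_cast; linarith), max_eq_left (by push_cast; linarith)]
  push_cast
  ring

lemma tent_of_add_le {m k l : ℕ} (hm : 0 < m) (h : (l + 1) * m ≤ k) : tent m k l = 0 := by
  have hm' : (0 : ℝ) < m := Nat.cast_pos.2 hm
  have h3 : (l : ℝ) + 1 ≤ k / m := by rw [le_div_iff₀ hm']; exact_mod_cast h
  rw [tent, abs_of_nonneg (by linarith), max_eq_right (by linarith)]

lemma tent_succ_of_le {m k l : ℕ} (hm : 0 < m) (h : k ≤ l * m) : tent m k (l + 1) = 0 := by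
  have hm' : (0 : ℝ) < m := Nat.cast_pos.2 hm
  have h3 : (k : ℝ) / m ≤ l := by rw [div_le_iff₀ hm']; exact_mod_cast h
  rw [tent, abs_of_nonpos (by push_cast; linarith), max_eq_right (by push_cast; linarith)]

/-- All servers have the same mean number of requested blocks, and these means add up to `k`. -/
lemma mean_brLawGiven {m : ℕ} (hm : 0 < m) {α : ℕ → ℕ} {k : ℕ} (hk : k ≤ α k) (i : Fin m) :
    ∑' r, brLawGiven m α k r * (r i : ℝ≥0∞) = (k : ℝ≥0∞) / m := by
  have hexch : ∀ j, ∑' r, brLawGiven m α k r * (r j : ℝ≥0∞)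
      = ∑' r, brLawGiven m α k r * (r i : ℝ≥0∞) := by
    intro j
    rw [← tsum_brLawGiven_comp α k (Equiv.swap i j) fun r => (r i : ℝ≥0∞)]
    simp
  have hsum : ∑ j : Fin m, ∑' r, brLawGiven m α k r * (r j : ℝ≥0∞) = k := by
    rw [← Summable.tsum_finsetSum fun _ _ => ENNReal.summable]
    simp_rw [← Finset.mul_sum, ← Nat.cast_sum]
    calc ∑' r, brLawGiven m α k r * ((∑ j, r j : ℕ) : ℝ≥0∞)
        = ∑' r, brLawGiven m α k r * (k : ℝ≥0∞) := by
          refine tsum_congr fun r => ?_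
          by_cases hr : brLawGiven m α k r = 0
          · simp [hr]
          · rw [(balanced_of_mem_support hm hk ((PMF.mem_support_iff _ _).2 hr)).1]
      _ = k := by rw [ENNReal.tsum_mul_right, PMF.tsum_coe, one_mul]
  simp_rw [hexch, Finset.sum_const, Finset.card_univ, Fintype.card_fin, nsmul_eq_mul] at hsum
  rw [ENNReal.eq_div_iff (by simpa using hm.ne') (ENNReal.natCast_ne_top m), hsum]

/-- Law of the number of blocks requested from a given server. As it is concentrated on two
neighbouring integers, it is determined by its mean. -/
lemma tsum_brLawGiven_coord {m : ℕ} (hm : 0 < m) {α : ℕ → ℕ} {k : ℕ} (hk : k ≤ α k) (i : Fin m)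
    (F : ℕ → ℝ≥0∞) :
    ∑' r, brLawGiven m α k r * F (r i) = ∑' l, ENNReal.ofReal (tent m k l) * F l := by
  classical
  set q := k / m with hq
  let p : ℕ → ℝ≥0∞ := fun l => ∑' r, brLawGiven m α k r * if r i = l then 1 else 0
  have htwo : ∀ F : ℕ → ℝ≥0∞,
      ∑' r, brLawGiven m α k r * F (r i) = p q * F q + p (q + 1) * F (q + 1) := by
    intro F
    simp only [p]
    rw [← ENNReal.tsum_mul_right, ← ENNReal.tsum_mul_right, ← ENNReal.tsum_add]
    refine tsum_congr fun r => ?_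
    by_cases hr : brLawGiven m α k r = 0
    · simp [hr]
    · rcases (balanced_of_mem_support hm hk ((PMF.mem_support_iff _ _).2 hr)).2 i with h | h <;>
        simp [h, ← hq]
  have h1 : p q + p (q + 1) = 1 := by
    have := htwo fun _ => 1
    simpa [PMF.tsum_coe] using this.symm
  have h2 : (q : ℝ≥0∞) + p (q + 1) = (k : ℝ≥0∞) / m := by
    have := htwo fun l => (l : ℝ≥0∞)
    rw [mean_brLawGiven hm hk] at this
    rw [this, Nat.cast_add, Nat.cast_one, mul_add, mul_one, ← add_assoc, ← add_mul, h1, one_mul]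
  have hfin : ∀ l, p q + p (q + 1) = 1 → l = q ∨ l = q + 1 → p l ≠ ∞ := by
    rintro l h (rfl | rfl)
    · exact ((le_self_add.trans h.le).trans_lt ENNReal.one_lt_top).ne
    · exact ((le_add_self.trans h.le).trans_lt ENNReal.one_lt_top).ne
  have hf0 := hfin q h1 (Or.inl rfl)
  have hf1 := hfin (q + 1) h1 (Or.inr rfl)
  have h1' : (p q).toReal + (p (q + 1)).toReal = 1 := by
    rw [← ENNReal.toReal_add hf0 hf1, h1, ENNReal.toReal_one]
  have h2' : (q : ℝ) + (p (q + 1)).toReal = (k : ℝ) / m := by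
    have := congrArg ENNReal.toReal h2
    rwa [ENNReal.toReal_add (ENNReal.natCast_ne_top q) hf1, ENNReal.toReal_div,
      ENNReal.toReal_natCast, ENNReal.toReal_natCast, ENNReal.toReal_natCast] at this
  have hb1 : q * m ≤ k := Nat.div_mul_le_self k m
  have hb2 : k ≤ (q + 1) * m := by
    have h3 := Nat.div_add_mod' k m
    have h4 := Nat.mod_lt k hm
    rw [← hq] at h3
    rw [add_mul, one_mul]
    omega
  have hp0 : p q = ENNReal.ofReal (tent m k q) := by
    rw [tent_of_le_of_le hm hb1 hb2, ← ENNReal.ofReal_toReal hf0]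
    congr 1
    linarith
  have hp1 : p (q + 1) = ENNReal.ofReal (tent m k (q + 1)) := by
    rw [tent_succ_of_le_of_le hm hb1 hb2, ← ENNReal.ofReal_toReal hf1]
    congr 1
    linarith
  rw [htwo, hp0, hp1, tsum_eq_sum (s := {q, q + 1}), Finset.sum_pair q.succ_ne_self.symm]
  intro l hl
  simp only [Finset.mem_insert, Finset.mem_singleton, not_or] at hl
  clear_value q
  clear hq
  have : tent m k l = 0 := by
    rcases Nat.lt_or_ge l q with h | h
    · exact tent_of_add_le hm ((Nat.mul_le_mul_right m h).trans hb1)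
    · obtain ⟨l, rfl⟩ : ∃ l', l = l' + 1 := ⟨l - 1, by omega⟩
      exact tent_succ_of_le hm (hb2.trans (Nat.mul_le_mul_right m (by omega)))
  simp [this]

lemma summable_toReal (π : PMF ℕ) : Summable fun k => (π k).toReal :=
  ENNReal.summable_toReal π.tsum_coe_ne_top

lemma tsum_toReal_eq_one (π : PMF ℕ) : ∑' k, (π k).toReal = 1 := by
  rw [← ENNReal.tsum_toReal_eq π.apply_ne_top, π.tsum_coe, ENNReal.toReal_one]

lemma cavityWeight_eq {m : ℕ} (hm : 0 < m) (π : PMF ℕ) (l : ℕ) :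
    cavityWeight m π l = ∑' k, tent m k l * (π k).toReal := by
  have hs := summable_toReal π
  cases l with
  | zero =>
    have hA : Summable fun k => if m + 1 ≤ k then (π k).toReal else 0 :=
      Summable.of_nonneg_of_le (fun k => by split_ifs <;> simp)
        (fun k => by split_ifs <;> simp) hs
    have hB : ∑ k ∈ Finset.Icc 1 m, (k : ℝ) / m * (π k).toReal
        = ∑' k, if k ∈ Finset.Icc 1 m then (k : ℝ) / m * (π k).toReal else 0 := by
      rw [tsum_eq_sum (s := Finset.Icc 1 m) fun k hk => if_neg hk]
      exact Finset.sum_congr rfl fun k hk => (if_pos hk).symm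
    have hBs : Summable fun k =>
        if k ∈ Finset.Icc 1 m then (k : ℝ) / m * (π k).toReal else 0 :=
      summable_of_ne_finset_zero (s := Finset.Icc 1 m) fun k hk => if_neg hk
    rw [cavityWeight, hB, ← tsum_toReal_eq_one π, ← hs.tsum_sub hBs, ← (hs.sub hBs).tsum_sub hA]
    refine tsum_congr fun k => ?_
    rcases Nat.lt_or_ge m k with h | h
    · rw [tent_of_add_le hm (by omega), if_neg (by simp; omega), if_pos (by omega)]
      ring
    · rw [tent_of_le_of_le hm (by omega) (by omega), if_neg (by omega : ¬ m + 1 ≤ k)]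
      by_cases hk : k = 0
      · subst hk
        simp
      · rw [if_pos (by simp; omega)]
        push_cast
        ring
  | succ l =>
    rw [tsum_eq_sum (s := Finset.Icc (l * m + 1) ((l + 1) * m) ∪
      Finset.Icc ((l + 1) * m + 1) ((l + 2) * m - 1)), Finset.sum_union, cavityWeight]
    · congr 1
      · refine Finset.sum_congr rfl fun k hk => ?_
        rw [Finset.mem_Icc] at hk
        rw [tent_succ_of_le_of_le hm (by omega) hk.2]
      · refine Finset.sum_congr rfl fun k hk => ?_
        rw [Finset.mem_Icc] at hk
        rw [tent_of_le_of_le hm (by omega) (by rw [add_assoc]; norm_num; omega)]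
        push_cast
        ring
    · rw [Finset.disjoint_left]
      intro k hk hk'
      rw [Finset.mem_Icc] at hk hk'
      omega
    · intro k hk
      simp only [Finset.mem_union, Finset.mem_Icc, not_or, not_and, not_le] at hk
      rcases Nat.lt_or_ge (l * m) k with h | h
      · have h2 : (l + 2) * m ≤ k := by
          by_contra hcon
          have := hk.1 (by omega)
          have := hk.2 (by omega)
          omega
        rw [tent_of_add_le hm h2, zero_mul]
      · rw [tent_succ_of_le hm h, zero_mul]

/-- Law of the number of blocks requested from a given server by an arrival. -/
lemma tsum_brLaw_coord {m : ℕ} (hm : 0 < m) {α : ℕ → ℕ} (hα : ∀ k, k ≤ α k) (π : PMF ℕ)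
    (i : Fin m) (F : ℕ → ℝ≥0∞) :
    ∑' r, brLaw m α π r * F (r i) = ∑' l, ENNReal.ofReal (cavityWeight m π l) * F l := by
  have hw : ∀ l, ENNReal.ofReal (cavityWeight m π l)
      = ∑' k, π k * ENNReal.ofReal (tent m k l) := by
    intro l
    have hnn : ∀ k, 0 ≤ tent m k l * (π k).toReal := fun k =>
      mul_nonneg (tent_nonneg _ _ _) ENNReal.toReal_nonneg
    rw [cavityWeight_eq hm, ENNReal.ofReal_tsum_of_nonneg hnn]
    · refine tsum_congr fun k => ?_
      rw [ENNReal.ofReal_mul (tent_nonneg _ _ _), ENNReal.ofReal_toReal (π.apply_ne_top k),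
        mul_comm]
    · exact Summable.of_nonneg_of_le hnn
        (fun k => mul_le_of_le_one_left ENNReal.toReal_nonneg (tent_le_one _ _ _))
        (summable_toReal π)
  rw [tsum_brLaw α π fun r => F (r i)]
  simp_rw [tsum_brLawGiven_coord hm (hα _), hw, ← ENNReal.tsum_mul_left, ← ENNReal.tsum_mul_right]
  rw [ENNReal.tsum_comm]
  simp_rw [mul_assoc]

/-- The service requirement in the cavity queue is distributed like the amount of work that an
arrival brings to any given server under the balanced random policy. -/
lemma measurePreserving_coord {m : ℕ} (hm : 0 < m) (c : ℝ) {α : ℕ → ℕ} (hα : ∀ k, k ≤ α k)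
    (π : PMF ℕ) (i : Fin m) :
    MeasurePreserving (fun r : Fin m → ℕ => c * (r i : ℝ)) (brLaw m α π).toMeasure
      (cavityServiceLaw m c π) := by
  have hmeas : Measurable fun r : Fin m → ℕ => c * (r i : ℝ) := measurable_of_countable _
  refine ⟨hmeas, Measure.ext fun B hB => ?_⟩
  rw [Measure.map_apply hmeas hB, ← lintegral_indicator_one (hmeas hB), lintegral_toMeasure,
    cavityServiceLaw, Measure.sum_apply _ hB]
  simp only [Measure.smul_apply, Measure.dirac_apply' _ hB, smul_eq_mul]
  rw [← tsum_brLaw_coord hm hα π i fun l => B.indicator 1 ((l : ℝ) * c)]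
  refine tsum_congr fun r => ?_
  simp only [mul_comm c]
  rfl

/-! ### The drift of the workload of a server -/

/-- The mean of the exponential distribution, read off from the normalization of the gamma density
with shape parameter `2`. -/
lemma lintegral_id_expMeasure {lam : ℝ} (hlam : 0 < lam) :
    ∫⁻ t, ENNReal.ofReal t ∂expMeasure lam = ENNReal.ofReal (1 / lam) := by
  have h1 : ∫⁻ t, ENNReal.ofReal t ∂expMeasure lam
      = ∫⁻ t, exponentialPDF lam t * ENNReal.ofReal t := by
    have hm : Measurable (exponentialPDF lam) :=
      (measurable_exponentialPDFReal lam).ennreal_ofReal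
    rw [expMeasure, gammaMeasure]
    exact lintegral_withDensity_eq_lintegral_mul _ hm ENNReal.measurable_ofReal
  have h2 : ∀ t, exponentialPDF lam t * ENNReal.ofReal t
      = ENNReal.ofReal (1 / lam) * gammaPDF 2 lam t := by
    intro t
    rcases lt_or_ge t 0 with ht | ht
    · rw [exponentialPDF_of_neg ht, gammaPDF_of_neg ht, zero_mul, mul_zero]
    · rw [exponentialPDF_of_nonneg ht, gammaPDF_of_nonneg ht, ← ENNReal.ofReal_mul (by positivity),
        ← ENNReal.ofReal_mul (by positivity), Real.Gamma_two]
      congr 1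
      norm_num
      field_simp
  simp_rw [h1, h2]
  have hm : Measurable (gammaPDF 2 lam) := (measurable_gammaPDFReal 2 lam).ennreal_ofReal
  rw [lintegral_const_mul _ hm,
    lintegral_gammaPDF_eq_one two_pos hlam, mul_one]

lemma ae_nonneg_expMeasure {lam : ℝ} : ∀ᵐ t ∂expMeasure lam, 0 ≤ t := by
  rw [ae_iff, expMeasure, gammaMeasure, withDensity_apply' _]
  refine setLIntegral_eq_zero (by measurability) fun t ht => ?_
  exact gammaPDF_of_neg (not_le.1 ht)

lemma integrable_of_nonneg_of_lintegral_eq {X : Type*} [MeasurableSpace X] {M : Measure X}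
    {f : X → ℝ} (hf : AEStronglyMeasurable f M) (hf0 : ∀ᵐ x ∂M, 0 ≤ f x) {y : ℝ} (hy : 0 ≤ y)
    (h : ∫⁻ x, ENNReal.ofReal (f x) ∂M = ENNReal.ofReal y) :
    Integrable f M ∧ ∫ x, f x ∂M = y := by
  refine ⟨⟨hf, ?_⟩, ?_⟩
  · rw [hasFiniteIntegral_iff_ofReal hf0, h]
    exact ENNReal.ofReal_lt_top
  · rw [integral_eq_lintegral_of_nonneg_ae hf0 hf, h, ENNReal.toReal_ofReal hy]

lemma integral_coord_brLaw {m : ℕ} (hm : 0 < m) {α : ℕ → ℕ} (hα : ∀ k, k ≤ α k) {π : PMF ℕ}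
    (hmean : Summable fun k : ℕ => (k : ℝ) * (π k).toReal) (i : Fin m) :
    Integrable (fun r : Fin m → ℕ => (r i : ℝ)) (brLaw m α π).toMeasure ∧
      ∫ r, (r i : ℝ) ∂(brLaw m α π).toMeasure = (∑' k : ℕ, (k : ℝ) * (π k).toReal) / m := by
  have hnn : ∀ k : ℕ, 0 ≤ (k : ℝ) * (π k).toReal := fun k => by positivity
  have hm' : (0 : ℝ) < m := Nat.cast_pos.2 hm
  refine integrable_of_nonneg_of_lintegral_eq (measurable_coord_cast i).aestronglyMeasurable
    (Eventually.of_forall fun r => Nat.cast_nonneg _) (div_nonneg (tsum_nonneg hnn) hm'.le) ?_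
  simp_rw [ENNReal.ofReal_natCast]
  rw [lintegral_toMeasure, tsum_brLaw α π fun r => (r i : ℝ≥0∞)]
  simp_rw [mean_brLawGiven hm (hα _)]
  rw [ENNReal.ofReal_div_of_pos hm', ENNReal.ofReal_tsum_of_nonneg hnn hmean,
    ENNReal.ofReal_natCast, div_eq_mul_inv, ← ENNReal.tsum_mul_right]
  refine tsum_congr fun k => ?_
  rw [ENNReal.ofReal_mul (Nat.cast_nonneg k), ENNReal.ofReal_natCast,
    ENNReal.ofReal_toReal (π.apply_ne_top k), div_eq_mul_inv]
  ring

/-- Subcriticality means that the workload of a server has negative drift. -/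
lemma integral_incrementLaw_neg {m : ℕ} (hm : 0 < m) {c lam mu : ℝ} (hlam : 0 < lam)
    {α : ℕ → ℕ} (hα : ∀ k, k ≤ α k) {π : PMF ℕ}
    (hmean : Summable fun k : ℕ => (k : ℝ) * (π k).toReal)
    (hload : c * lam * (∑' k : ℕ, (k : ℝ) * (π k).toReal) / m < mu) (i : Fin m) :
    Integrable (fun x => x) (incrementLaw c mu (brLaw m α π) (expMeasure lam) i) ∧
      ∫ x, x ∂incrementLaw c mu (brLaw m α π) (expMeasure lam) i < 0 := by
  have := isProbabilityMeasure_expMeasure hlam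
  obtain ⟨hr, hr'⟩ := integral_coord_brLaw hm hα hmean i
  obtain ⟨ht, ht'⟩ := integrable_of_nonneg_of_lintegral_eq (M := expMeasure lam) (f := fun t => t)
    (by fun_prop) ae_nonneg_expMeasure (by positivity) (lintegral_id_expMeasure hlam)
  have hA : Integrable (fun z : (Fin m → ℕ) × ℝ => c * (z.1 i : ℝ))
      ((brLaw m α π).toMeasure.prod (expMeasure lam)) := (hr.const_mul c).comp_fst _
  have hB : Integrable (fun z : (Fin m → ℕ) × ℝ => mu * z.2)
      ((brLaw m α π).toMeasure.prod (expMeasure lam)) := (ht.const_mul mu).comp_snd _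
  have hmp := (measurable_increment c mu i).measurePreserving
    ((brLaw m α π).toMeasure.prod (expMeasure lam))
  refine ⟨(hmp.integrable_comp (by fun_prop)).1 (hA.sub hB), ?_⟩
  have hval : ∫ x, x ∂incrementLaw c mu (brLaw m α π) (expMeasure lam) i
      = c * ((∑' k : ℕ, (k : ℝ) * (π k).toReal) / m) - mu * (1 / lam) := by
    rw [incrementLaw, integral_map (measurable_increment c mu i).aemeasurable (by fun_prop),
      integral_sub hA hB, integral_fun_fst fun r : Fin m → ℕ => c * (r i : ℝ),
      integral_fun_snd fun t : ℝ => mu * t, integral_const_mul, integral_const_mul, hr', ht']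
    simp
  rw [hval, sub_neg, mul_one_div, lt_div_iff₀ hlam]
  refine lt_of_eq_of_lt ?_ hload
  ring

/-- Stationarity of a workload law in the cavity queue is invariance under the Lindley recursion of
a single server. -/
lemma isStationaryWorkload_iff {m : ℕ} (hm : 0 < m) (c mu : ℝ) {lam : ℝ} (hlam : 0 < lam)
    {α : ℕ → ℕ} (hα : ∀ k, k ≤ α k) (π : PMF ℕ) (i : Fin m) (ν : Measure ℝ) :
    IsStationaryWorkload lam mu (cavityServiceLaw m c π) ν ↔
      IsProbabilityMeasure ν ∧
        lindleyStep (incrementLaw c mu (brLaw m α π) (expMeasure lam) i) ν = ν := by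
  have := isProbabilityMeasure_expMeasure hlam
  refine and_congr_right fun hν => ?_
  have hσ := measurePreserving_coord hm c hα π i
  have : SFinite (cavityServiceLaw m c π) := by rw [← hσ.map_eq]; infer_instance
  have h1 := (MeasurePreserving.id ν).prod (hσ.prod (MeasurePreserving.id (expMeasure lam)))
  have h2 := (MeasurePreserving.id ν).prod ((measurable_increment c mu i).measurePreserving
    ((brLaw m α π).toMeasure.prod (expMeasure lam)))
  have : lindleyStep (incrementLaw c mu (brLaw m α π) (expMeasure lam) i) ν
      = (ν.prod ((cavityServiceLaw m c π).prod (expMeasure lam))).map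
        (fun z : ℝ × ℝ × ℝ => max (z.1 + z.2.1 - mu * z.2.2) 0) := by
    rw [← h1.map_eq, Measure.map_map (by fun_prop) h1.measurable, lindleyStep, incrementLaw,
      ← h2.map_eq, Measure.map_map (by fun_prop) h2.measurable]
    congr 1
    funext z
    simp [add_sub_assoc]
  rw [this]

/-! ### Increasing convex order -/

/-- For nonnegative random variables, the increasing convex order can be tested on functions with
values in `[0, ∞]`. -/
lemma icxLE_of_lintegral_le {Ω Ω' : Type*} [MeasurableSpace Ω] [MeasurableSpace Ω']
    {X : Ω → ℝ} {P : Measure Ω} [IsProbabilityMeasure P] {Y : Ω' → ℝ} {Q : Measure Ω'}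
    [IsProbabilityMeasure Q] (hX : Measurable X)
    (hX0 : ∀ᵐ ω ∂P, 0 ≤ X ω) (hY0 : ∀ᵐ ω ∂Q, 0 ≤ Y ω)
    (h : ∀ g : ℝ → ℝ, Monotone g → ConvexOn ℝ Set.univ g →
      ∫⁻ ω, ENNReal.ofReal (g (X ω)) ∂P ≤ ∫⁻ ω, ENNReal.ofReal (g (Y ω)) ∂Q) :
    IcxLE X P Y Q := by
  intro g hg hconv hint
  -- subtracting `g 0` makes both random variables nonnegative without changing the comparison
  have hg' : Monotone fun x => g x - g 0 := fun x y hxy => sub_le_sub_right (hg hxy) _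
  have hconv' : ConvexOn ℝ Set.univ fun x => g x - g 0 := by
    have hsub : (fun x => g x - g 0) = g + fun _ => -g 0 := funext fun x => sub_eq_add_neg _ _
    rw [hsub]
    exact hconv.add_const _
  have key := h _ hg' hconv'
  have hXp : ∀ᵐ ω ∂P, 0 ≤ g (X ω) - g 0 := hX0.mono fun ω hω => sub_nonneg.2 (hg hω)
  have hYp : ∀ᵐ ω ∂Q, 0 ≤ g (Y ω) - g 0 := hY0.mono fun ω hω => sub_nonneg.2 (hg hω)
  have hYi : Integrable (fun ω => g (Y ω) - g 0) Q := hint.sub (integrable_const _)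
  have hYfin : ∫⁻ ω, ENNReal.ofReal (g (Y ω) - g 0) ∂Q < ∞ :=
    (hasFiniteIntegral_iff_ofReal hYp).1 hYi.2
  have hXm : AEStronglyMeasurable (fun ω => g (X ω) - g 0) P :=
    ((hg.measurable.comp hX).sub_const _).aestronglyMeasurable
  have hXi : Integrable (fun ω => g (X ω) - g 0) P :=
    ⟨hXm, (hasFiniteIntegral_iff_ofReal hXp).2 (key.trans_lt hYfin)⟩
  have hXg : Integrable (fun ω => g (X ω)) P := by
    have := hXi.add (integrable_const (g 0))
    exact this.congr (Eventually.of_forall fun ω => sub_add_cancel _ _)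
  refine ⟨hXg, ?_⟩
  have hle : ∫ ω, g (X ω) - g 0 ∂P ≤ ∫ ω, g (Y ω) - g 0 ∂Q := by
    rw [integral_eq_lintegral_of_nonneg_ae hXp hXm, integral_eq_lintegral_of_nonneg_ae hYp hYi.1]
    exact ENNReal.toReal_mono hYfin.ne key
  rw [integral_sub hXg (integrable_const _), integral_sub hint (integrable_const _)] at hle
  simpa using hle

lemma measurable_delay_prod {m : ℕ} (c : ℝ) :
    Measurable fun z : (Fin m → ℝ) × (Fin m → ℕ) => delay c z.1 z.2 :=
  measurable_from_prod_countable_left fun r => measurable_delay c r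

end MDSDelivery

end

open MDSDelivery in
theorem mainTheorem5 {Ω : Type*} [mΩ : MeasurableSpace Ω] (P : Measure Ω) [IsProbabilityMeasure P]
    (ℱ : Filtration ℕ mΩ)
    (m : ℕ) (hm : 0 < m) (c lam mu : ℝ) (hc : 0 < c) (hlam : 0 < lam) (hmu : 0 < mu)
    (α : ℕ → ℕ) (hα : ∀ k, k ≤ α k)
    (π : PMF ℕ) (hπ : π ∈ Theta m α)
    (hmean : Summable fun k : ℕ => (k : ℝ) * (π k).toReal)
    (hload : c * lam * (∑' k : ℕ, (k : ℝ) * (π k).toReal) / m < mu)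
    (p : Policy)
    (κ : ℕ → Ω → ℕ) (a s : ℕ → Ω → Fin m → ℕ) (τ : ℕ → Ω → ℝ)
    (hsys : IsSystem P ℱ m c lam mu α π p κ a s τ) :
    ∃ ν : Measure ℝ,
      IsStationaryWorkload lam mu (cavityServiceLaw m c π) ν ∧
      (∀ ν' : Measure ℝ,
        IsStationaryWorkload lam mu (cavityServiceLaw m c π) ν' → ν' = ν) ∧
      ∀ n k : ℕ, π k ≠ 0 →
        IcxLE (fun ω => delay c (workload c mu s τ n ω) (s n ω))
          (ProbabilityTheory.cond P (κ n ⁻¹' {k}))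
          (fun z : (Fin m → ℝ) × (Fin m → ℕ) => delay c z.1 z.2)
          ((Measure.pi fun _ : Fin m => ν).prod (brLawGiven m α k).toMeasure) := by
  have := isProbabilityMeasure_expMeasure hlam
  set i₀ : Fin m := ⟨0, hm⟩
  obtain ⟨hint, hneg⟩ := integral_incrementLaw_neg hm hlam hα hmean hload i₀
  obtain ⟨ν, hν, hinv, huniq, hdom⟩ := exists_unique_lindley_invariant _ hint hneg
  have hstat : IsStationaryWorkload lam mu (cavityServiceLaw m c π) ν :=
    (isStationaryWorkload_iff hm c mu hlam hα π i₀ ν).2 ⟨hν, hinv⟩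
  refine ⟨ν, hstat, fun ν' h' => ?_, fun n k hk => ?_⟩
  · obtain ⟨h1, h2⟩ := (isStationaryWorkload_iff hm c mu hlam hα π i₀ ν').1 h'
    exact huniq ν' h1 h2
  have hκ : Measurable (κ n) := (hsys.measurable_size n).mono (ℱ.le _) le_rfl
  have hsize := hsys.measure_size n k
  have hcond : IsProbabilityMeasure (ProbabilityTheory.cond P (κ n ⁻¹' {k})) :=
    cond_isProbabilityMeasure (by rw [hsize]; exact hk)
  have hnonneg : ∀ᵐ w ∂Measure.pi fun _ : Fin m => ν, 0 ≤ w := by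
    have hν0 : ∀ᵐ x ∂ν, 0 ≤ x := by
      rw [← hinv, lindleyStep, ae_map_iff (by fun_prop) measurableSet_Ici]
      exact Filter.Eventually.of_forall fun z => le_max_right _ _
    have : ∀ i : Fin m, ∀ᵐ w ∂Measure.pi fun _ : Fin m => ν, 0 ≤ w i := fun i =>
      (measurePreserving_eval (fun _ : Fin m => ν) i).quasiMeasurePreserving.ae hν0
    filter_upwards [ae_all_iff.2 this] with w hw i using hw i
  refine icxLE_of_lintegral_le ?_ ?_ ?_ fun g hg hconv => ?_
  · exact (measurable_delay_prod c).comp (((hsys.measurable_workload n).mono (ℱ.le _) le_rfl).prodMk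
      ((hsys.measurable_routing n).mono (ℱ.le _) le_rfl))
  · exact Filter.Eventually.of_forall fun ω =>
      delay_nonneg hc.le (workload_nonneg c mu s τ n ω) _
  · filter_upwards [Measure.quasiMeasurePreserving_fst.ae hnonneg] with z hz
    exact delay_nonneg hc.le hz _
  set M := (chainStep c mu (brLaw m α π) (expMeasure lam))^[n] (Measure.dirac 0) with hM
  have hMp : IsProbabilityMeasure M := isProbabilityMeasure_iterate_chainStep _ _ _ _ _ n
  have hassoc : AssociatedLaw M := associatedLaw_iterate_chainStep hc.le hmu.le hπ _ n
  -- the chain starts from empty servers, so each of them stays below its stationary law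
  have hmarg : ∀ i (L : Set ℝ), IsLowerSet L → ν L ≤ M {w | w i ∈ L} := by
    intro i L hL
    -- the increments of all servers have the same law, so `ν` is invariant for server `i` as well
    obtain ⟨hint', hneg'⟩ := integral_incrementLaw_neg hm hlam hα hmean hload i
    obtain ⟨ν', hν', hinv', -, hdom'⟩ := exists_unique_lindley_invariant _ hint' hneg'
    obtain ⟨h1, h2⟩ := (isStationaryWorkload_iff hm c mu hlam hα π i₀ ν').1
      ((isStationaryWorkload_iff hm c mu hlam hα π i ν').2 ⟨hν', hinv'⟩)
    rw [← huniq ν' h1 h2]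
    refine (hdom' n L hL).trans (le_of_eq ?_)
    have := map_eval_iterate_chainStep c mu (brLaw m α π) (expMeasure lam)
      (Measure.dirac (0 : Fin m → ℝ)) i n
    rw [Measure.map_dirac' (measurable_pi_apply i)] at this
    rw [show (0 : ℝ) = (0 : Fin m → ℝ) i from rfl, ← this,
      Measure.map_apply (measurable_pi_apply i) hL.ordConnected.measurableSet]
    rfl
  have hG : Measurable fun z : (Fin m → ℝ) × (Fin m → ℕ) => ENNReal.ofReal (g (delay c z.1 z.2)) :=
    (hg.measurable.comp (measurable_delay_prod c)).ennreal_ofReal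
  have hdelay := hsys.setLIntegral_delay_le hm hc hlam hα n k hg hconv
  rw [ProbabilityTheory.cond, lintegral_smul_measure, hsize, lintegral_prod_symm' _ hG,
    lintegral_toMeasure, smul_eq_mul]
  calc (π k)⁻¹ * ∫⁻ ω in κ n ⁻¹' {k},
        ENNReal.ofReal (g (delay c (workload c mu s τ n ω) (s n ω))) ∂P
      ≤ (π k)⁻¹ * (π k * ∑' r, brLawGiven m α k r *
          ∫⁻ w, ENNReal.ofReal (g (delay c w r)) ∂M) := mul_le_mul_right hdelay _
    _ = ∑' r, brLawGiven m α k r * ∫⁻ w, ENNReal.ofReal (g (delay c w r)) ∂M := by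
        rw [← mul_assoc, ENNReal.inv_mul_cancel hk (π.apply_ne_top k), one_mul]
    _ ≤ _ := ENNReal.tsum_le_tsum fun r =>
        mul_le_mul_right (hassoc.lintegral_delay_le hmarg c r hg) _
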